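/- Let $F$ be Thompson's group: the group of all strictly increasing homeomorphisms of $[0,1]$ that are piecewise linear with finitely many breakpoints, all of them dyadic rationals, and whose slopes are integer powers of $2$. Let $x_0,x_1\in F$ be the standard generators $$x_0(t)=\begin{cases}\frac t2,&0\le t\le\frac12,\\ t-\frac14,&\frac12\le t\le\frac34,\\ 2t-1,&\frac34\le t\le1,\end{cases}\qquad x_1(t)=\begin{cases}t,&0\le t\le\frac12,\\ \frac t2+\frac14,&\frac12\le t\le\frac34,\\ t-\frac18,&\frac34\le t\le\frac78,\\ 2t-1,&\frac78\le t\le1.\end{cases}$$ The standard action of $F$ on the Cantor set $\{0,1\}^\omega$ is the one induced by the action on $[0,1]$ through binary expansions: $f(w)$ is the binary expansion of $f(0.w)$, where $f(w)$ ends in $000\ldots$ if and only if $w$ does. Thus $x_0$ acts by $0w\mapsto00w$, $10w\mapsto01w$, $11w\mapsto1w$, and $x_1$ acts by $0w\mapsto0w$, $10w\mapsto100w$, $110w\mapsto101w$, $111w\mapsto11w$. For $y\in[0,1]$ let $\Gamma_y$ be the pointed Schreier graph of $y$: its vertex set is the orbit $Fy$, its base vertex is $y$, and for each vertex $u$ and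 $i\in\{0,1\}$ there is an arrow labeled $x_i$ from $u$ to $x_i(u)$. The connected pointed graphs with arrows labeled by $x_0,x_1$, such that every vertex has exactly one outgoing and exactly one incoming arrow of each label, form, up to isomorphism, a space $\mathcal T$ with the topology of the metric $d=2^{-n}$, where $n$ is the largest integer for which the balls of radius $n$ around the base vertices are isomorphic as labeled pointed graphs. For $x\in(0,1)$ put $\mathcal C_x=\{\Gamma_y : y\in Fx\}\subset\mathcal T$. The perfect kernel of a closed set is what remains after removing isolated points transfinitely often. Let $\mathcal D$ be the perfect kernel of $\overline{\mathcal C_{1/2}}$. **Theorem.** For every $x\in(0,1)$ the perfect kernel of $\overline{\mathcal C_x}$ is equal to $\mathcal D$. The action of $F$ on $\mathcal C_x$ by shifting the base vertex, $\Gamma_y\mapsto\Gamma_{f(y)}$ for $f\in F$, extends uniquely to an action of $F$ by homeomorphisms on $\overline{\mathcal C_x}$ (the Schreier dynamical system of the orbit of $x$). This action preserves $\mathcal D$, and its restriction to $\mathcal D$ is topologically conjugate to the standard action of $F$ on $\{0,1\}^\omega$: there is a homeomorphism $\psi:\mathcal D\to\{0,1\}^\omega$, which can be chosen independently of $x$,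 such that $\psi(f\cdot\Gamma)=f(\psi(\Gamma))$ for all $f\in F$ and $\Gamma\in\mathcal D$. -/

import Mathlib

open Set Topology unitInterval

noncomputable section

/-! ### Thompson's group `F` -/

/-- Dyadic rational numbers, as real numbers. -/
def IsDyadic (r : ℝ) : Prop := ∃ (k : ℤ) (n : ℕ), r = k / 2 ^ n

theorem IsDyadic.add {r s : ℝ} (hr : IsDyadic r) (hs : IsDyadic s) : IsDyadic (r + s) := by
  obtain ⟨k, n, rfl⟩ := hr
  obtain ⟨l, m, rfl⟩ := hs
  refine ⟨k * 2 ^ m + l * 2 ^ n, n + m, ?_⟩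
  push_cast
  field_simp
  ring

theorem IsDyadic.neg {r : ℝ} (hr : IsDyadic r) : IsDyadic (-r) := by
  obtain ⟨k, n, rfl⟩ := hr
  exact ⟨-k, n, by push_cast; ring⟩

theorem IsDyadic.mul {r s : ℝ} (hr : IsDyadic r) (hs : IsDyadic s) : IsDyadic (r * s) := by
  obtain ⟨k, n, rfl⟩ := hr
  obtain ⟨l, m, rfl⟩ := hs
  refine ⟨k * l, n + m, ?_⟩
  push_cast
  field_simp
  ring

theorem IsDyadic.two_zpow (k : ℤ) : IsDyadic ((2 : ℝ) ^ k) := by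
  obtain ⟨n, rfl | rfl⟩ := k.eq_nat_or_neg
  · exact ⟨2 ^ n, 0, by simp⟩
  · exact ⟨1, n, by simp⟩

theorem IsDyadic.zero : IsDyadic 0 := ⟨0, 0, by simp⟩

/-- `f` is piecewise linear with dyadic breakpoints and slopes integer powers of `2`: there is a
finite set `B` of dyadic rationals such that on every interval `[s, t]` without points of `B` in
its interior, `f` has the form `u ↦ 2 ^ k * u + c` with `k` an integer. -/
def IsDyadicPL (f : I → I) : Prop :=
  ∃ B : Finset I, (∀ b ∈ B, IsDyadic b) ∧
    ∀ s t : I, s < t → (∀ b ∈ B, ¬ (s < b ∧ b < t)) →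
      ∃ (k : ℤ) (c : ℝ), ∀ u ∈ Icc s t, (f u : ℝ) = 2 ^ k * (u : ℝ) + c

theorem IsDyadicPL.isDyadic_apply {f : I → I} (hf : IsDyadicPL f) (h0 : f 0 = 0) {t : I}
    (ht : IsDyadic t) : IsDyadic (f t) := by
  classical
  obtain ⟨B, hB, hlin⟩ := hf
  have key : ∀ (n : ℕ) (t : I), (B.filter (· < t)).card ≤ n → IsDyadic t → IsDyadic (f t) := by
    have step : ∀ s t : I, s < t → (∀ b ∈ B, ¬ (s < b ∧ b < t)) → IsDyadic s → IsDyadic t →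
        IsDyadic (f s) → IsDyadic (f t) := by
      intro s t hst hno hs ht hfs
      obtain ⟨k, c, hk⟩ := hlin s t hst hno
      have h1 := hk s ⟨le_rfl, hst.le⟩
      have h2 := hk t ⟨hst.le, le_rfl⟩
      have : (f t : ℝ) = f s + 2 ^ k * ((t : ℝ) + -s) := by rw [h1, h2]; ring
      rw [this]
      exact hfs.add ((IsDyadic.two_zpow k).mul (ht.add hs.neg))
    have zero_case : ∀ t : I, (∀ b ∈ B, ¬ (b < t)) → IsDyadic t → IsDyadic (f t) := by
      intro t hno ht
      rcases (unitInterval.nonneg' (t := t)).eq_or_lt with h | h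
      · rw [← h, h0]; exact IsDyadic.zero
      · exact step 0 t h (fun b hb hbt => hno b hb hbt.2) IsDyadic.zero ht
          (by rw [h0]; exact IsDyadic.zero)
    intro n
    induction n with
    | zero =>
      intro t hc ht
      refine zero_case t (fun b hb hbt => ?_) ht
      have : b ∈ B.filter (· < t) := by simp [hb, hbt]
      rw [Finset.card_eq_zero.mp (Nat.le_zero.mp hc)] at this
      simp at this
    | succ n ih =>
      intro t hc ht
      by_cases hne : (B.filter (· < t)).Nonempty
      · set s := (B.filter (· < t)).max' hne with hs
        have hsm : s ∈ B.filter (· < t) := Finset.max'_mem _ _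
        have hsB : s ∈ B ∧ s < t := by simpa using hsm
        refine step s t hsB.2 (fun b hb hbt => ?_) (hB s hsB.1) ht (ih s ?_ (hB s hsB.1))
        · have : b ≤ s := Finset.le_max' _ b (by simp [hb, hbt.2])
          exact absurd hbt.1 (not_lt.mpr this)
        · have : (B.filter (· < s)).card < (B.filter (· < t)).card := by
            apply Finset.card_lt_card
            refine ⟨fun b hb => ?_, fun h => ?_⟩
            · simp only [Finset.mem_filter] at hb ⊢
              exact ⟨hb.1, hb.2.trans hsB.2⟩
            · have := h hsm
              simp at this
          omega
      · refine zero_case t (fun b hb hbt => hne ⟨b, by simp [hb, hbt]⟩) ht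
  exact key _ t le_rfl ht

theorem strictMono_homeomorph_zero (f : I ≃ₜ I) (hf : StrictMono f) : f 0 = 0 := by
  apply le_antisymm _ unitInterval.nonneg'
  calc f 0 ≤ f (f.symm 0) := hf.monotone unitInterval.nonneg'
    _ = 0 := f.apply_symm_apply 0

theorem strictMono_homeomorph_symm (f : I ≃ₜ I) (hf : StrictMono f) : StrictMono f.symm := by
  intro a b hab
  rw [← hf.lt_iff_lt]
  simpa using hab

theorem IsDyadicPL.symm {f : I ≃ₜ I} (hm : StrictMono f) (hf : IsDyadicPL f) :
    IsDyadicPL f.symm := by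
  classical
  have h0 := strictMono_homeomorph_zero f hm
  have hf' := hf
  obtain ⟨B, hB, hlin⟩ := hf
  refine ⟨B.image f, ?_, ?_⟩
  · intro b hb
    obtain ⟨a, ha, rfl⟩ := Finset.mem_image.mp hb
    exact hf'.isDyadic_apply h0 (hB a ha)
  · intro s t hst hno
    have hms := strictMono_homeomorph_symm f hm
    obtain ⟨k, c, hk⟩ := hlin (f.symm s) (f.symm t) (hms hst) (fun b hb hbt => by
      refine hno (f b) (Finset.mem_image_of_mem _ hb) ⟨?_, ?_⟩
      · simpa using hm hbt.1
      · simpa using hm hbt.2)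
    refine ⟨-k, -(2 ^ (-k) * c), fun u hu => ?_⟩
    have := hk (f.symm u) ⟨hms.monotone hu.1, hms.monotone hu.2⟩
    rw [f.apply_symm_apply] at this
    rw [this, zpow_neg]
    field_simp
    ring

/-- Thompson's group `F`: the increasing homeomorphisms of `[0, 1]` that are piecewise linear with
finitely many breakpoints, all dyadic, and with slopes integer powers of `2`. The product
`f * g` is the map `t ↦ f (g t)`. -/
def ThompsonF : Subgroup (I ≃ₜ I) where
  carrier := {f | StrictMono f ∧ IsDyadicPL f}
  one_mem' := ⟨fun _ _ h => h, ∅, by simp, fun s t _ _ => ⟨0, 0, by simp⟩⟩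
  inv_mem' := fun {f} hf => ⟨strictMono_homeomorph_symm f hf.1, hf.2.symm hf.1⟩
  mul_mem' := by
    classical
    rintro f g ⟨hfm, hf⟩ ⟨hgm, hg⟩
    refine ⟨hfm.comp hgm, ?_⟩
    have hgs := hg.symm hgm
    have hgsm := strictMono_homeomorph_symm g hgm
    have h0 := strictMono_homeomorph_zero g.symm hgsm
    obtain ⟨B, hB, hlin⟩ := hf
    obtain ⟨C, hC, hlin'⟩ := hg
    refine ⟨C ∪ B.image g.symm, ?_, ?_⟩
    · intro b hb
      rcases Finset.mem_union.mp hb with hb | hb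
      · exact hC b hb
      · obtain ⟨a, ha, rfl⟩ := Finset.mem_image.mp hb
        exact hgs.isDyadic_apply h0 (hB a ha)
    · intro s t hst hno
      obtain ⟨k, c, hk⟩ := hlin' s t hst
        (fun b hb => hno b (Finset.mem_union_left _ hb))
      obtain ⟨l, d, hl⟩ := hlin (g s) (g t) (hgm hst) (fun b hb hbt => by
        refine hno (g.symm b) (Finset.mem_union_right _ (Finset.mem_image_of_mem _ hb)) ⟨?_, ?_⟩
        · simpa using hgsm hbt.1
        · simpa using hgsm hbt.2)
      refine ⟨l + k, 2 ^ l * c + d, fun u hu => ?_⟩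
      have h1 := hk u hu
      have h2 := hl (g u) ⟨hgm.monotone hu.1, hgm.monotone hu.2⟩
      simp only [Homeomorph.mul_apply]
      rw [h2, h1, zpow_add₀ (by norm_num)]
      ring

/-- The action of `F` on the unit interval. -/
instance : MulAction ThompsonF I where
  smul f t := f.1 t
  one_smul _ := rfl
  mul_smul _ _ _ := rfl

theorem ThompsonF.smul_def (f : ThompsonF) (t : I) : f • t = f.1 t := rfl

/-- The map `x₀` on real numbers. -/
def x₀Fun (t : ℝ) : ℝ := if t ≤ 1 / 2 then t / 2 else if t ≤ 3 / 4 then t - 1 / 4 else 2 * t - 1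

/-- The map `x₁` on real numbers. -/
def x₁Fun (t : ℝ) : ℝ :=
  if t ≤ 1 / 2 then t else if t ≤ 3 / 4 then t / 2 + 1 / 4 else
    if t ≤ 7 / 8 then t - 1 / 8 else 2 * t - 1

theorem x₀Fun_mem (t : I) : x₀Fun t ∈ I := by
  have h0 := t.2.1
  have h1 := t.2.2
  unfold x₀Fun
  split_ifs <;> constructor <;> linarith

theorem x₁Fun_mem (t : I) : x₁Fun t ∈ I := by
  have h0 := t.2.1
  have h1 := t.2.2
  unfold x₁Fun
  split_ifs <;> constructor <;> linarith

theorem x₀Fun_strictMono : StrictMono (fun t : I => (⟨x₀Fun t, x₀Fun_mem t⟩ : I)) := by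
  intro a b hab
  have hab : (a : ℝ) < b := hab
  change x₀Fun a < x₀Fun b
  unfold x₀Fun
  split_ifs <;> linarith

theorem x₁Fun_strictMono : StrictMono (fun t : I => (⟨x₁Fun t, x₁Fun_mem t⟩ : I)) := by
  intro a b hab
  have hab : (a : ℝ) < b := hab
  change x₁Fun a < x₁Fun b
  unfold x₁Fun
  split_ifs <;> linarith

theorem x₀Fun_surjective : Function.Surjective (fun t : I => (⟨x₀Fun t, x₀Fun_mem t⟩ : I)) := by
  rintro ⟨s, h0, h1⟩
  have hm : (if s ≤ 1 / 4 then 2 * s else if s ≤ 1 / 2 then s + 1 / 4 else (s + 1) / 2) ∈ I := by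
    split_ifs <;> constructor <;> linarith
  refine ⟨⟨_, hm⟩, Subtype.ext ?_⟩
  simp only [x₀Fun]
  split_ifs <;> linarith

theorem x₁Fun_surjective : Function.Surjective (fun t : I => (⟨x₁Fun t, x₁Fun_mem t⟩ : I)) := by
  rintro ⟨s, h0, h1⟩
  have hm : (if s ≤ 1 / 2 then s else if s ≤ 5 / 8 then 2 * s - 1 / 2 else
      if s ≤ 3 / 4 then s + 1 / 8 else (s + 1) / 2) ∈ I := by
    split_ifs <;> constructor <;> linarith
  refine ⟨⟨_, hm⟩, Subtype.ext ?_⟩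
  simp only [x₁Fun]
  split_ifs <;> linarith

theorem x₀Fun_isDyadicPL : IsDyadicPL (fun t : I => (⟨x₀Fun t, x₀Fun_mem t⟩ : I)) := by
  classical
  refine ⟨{⟨1 / 2, by norm_num, by norm_num⟩, ⟨3 / 4, by norm_num, by norm_num⟩}, ?_, ?_⟩
  · intro b hb
    simp only [Finset.mem_insert, Finset.mem_singleton] at hb
    rcases hb with rfl | rfl
    · exact ⟨1, 1, by norm_num⟩
    · exact ⟨3, 2, by norm_num⟩
  · intro s t hst hno
    have hst : (s : ℝ) < t := hst
    simp only [Finset.mem_insert, Finset.mem_singleton, forall_eq_or_imp, forall_eq,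
      ← Subtype.coe_lt_coe, not_and, not_lt] at hno
    obtain ⟨ha, hb⟩ := hno
    have hu : ∀ u ∈ Icc s t, (s : ℝ) ≤ u ∧ (u : ℝ) ≤ t := fun u h => ⟨h.1, h.2⟩
    rcases lt_or_ge (s : ℝ) (1 / 2) with h | h
    · refine ⟨-1, 0, fun u hu' => ?_⟩
      have := hu u hu'
      have := ha h
      simp only [x₀Fun]
      rw [if_pos (by linarith)]
      norm_num
      ring
    rcases lt_or_ge (s : ℝ) (3 / 4) with h' | h'
    · refine ⟨0, -1 / 4, fun u hu' => ?_⟩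
      have := hu u hu'
      have := hb h'
      simp only [x₀Fun, zpow_zero]
      split_ifs <;> linarith
    · refine ⟨1, -1, fun u hu' => ?_⟩
      have := hu u hu'
      simp only [x₀Fun, zpow_one]
      split_ifs <;> linarith

theorem x₁Fun_isDyadicPL : IsDyadicPL (fun t : I => (⟨x₁Fun t, x₁Fun_mem t⟩ : I)) := by
  classical
  refine ⟨{⟨1 / 2, by norm_num, by norm_num⟩, ⟨3 / 4, by norm_num, by norm_num⟩,
    ⟨7 / 8, by norm_num, by norm_num⟩}, ?_, ?_⟩
  · intro b hb
    simp only [Finset.mem_insert, Finset.mem_singleton] at hb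
    rcases hb with rfl | rfl | rfl
    · exact ⟨1, 1, by norm_num⟩
    · exact ⟨3, 2, by norm_num⟩
    · exact ⟨7, 3, by norm_num⟩
  · intro s t hst hno
    have hst : (s : ℝ) < t := hst
    simp only [Finset.mem_insert, Finset.mem_singleton, forall_eq_or_imp, forall_eq,
      ← Subtype.coe_lt_coe, not_and, not_lt] at hno
    obtain ⟨ha, hb, hc⟩ := hno
    have hu : ∀ u ∈ Icc s t, (s : ℝ) ≤ u ∧ (u : ℝ) ≤ t := fun u h => ⟨h.1, h.2⟩
    rcases lt_or_ge (s : ℝ) (1 / 2) with h | h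
    · refine ⟨0, 0, fun u hu' => ?_⟩
      have := hu u hu'
      have := ha h
      simp only [x₁Fun, zpow_zero]
      split_ifs <;> linarith
    rcases lt_or_ge (s : ℝ) (3 / 4) with h' | h'
    · refine ⟨-1, 1 / 4, fun u hu' => ?_⟩
      have := hu u hu'
      have := hb h'
      simp only [x₁Fun, zpow_neg, zpow_one]
      split_ifs <;> linarith
    rcases lt_or_ge (s : ℝ) (7 / 8) with h'' | h''
    · refine ⟨0, -1 / 8, fun u hu' => ?_⟩
      have := hu u hu'
      have := hc h''
      simp only [x₁Fun, zpow_zero]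
      split_ifs <;> linarith
    · refine ⟨1, -1, fun u hu' => ?_⟩
      have := hu u hu'
      simp only [x₁Fun, zpow_one]
      split_ifs <;> linarith

/-- The generator `x₀` of `F`. -/
def x₀ : ThompsonF :=
  ⟨(StrictMono.orderIsoOfSurjective _ x₀Fun_strictMono x₀Fun_surjective).toHomeomorph,
    x₀Fun_strictMono, x₀Fun_isDyadicPL⟩

/-- The generator `x₁` of `F`. -/
def x₁ : ThompsonF :=
  ⟨(StrictMono.orderIsoOfSurjective _ x₁Fun_strictMono x₁Fun_surjective).toHomeomorph,
    x₁Fun_strictMono, x₁Fun_isDyadicPL⟩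

theorem coe_x₀_smul (t : I) : ((x₀ • t : I) : ℝ) = x₀Fun t := rfl

theorem coe_x₁_smul (t : I) : ((x₁ • t : I) : ℝ) = x₁Fun t := rfl

/-! ### The standard action of `F` on the Cantor set -/

/-- The Cantor set `{0, 1}^ω` of infinite binary words, with the product topology. -/
abbrev BinSeq := ℕ → Fin 2

/-- The point of `[0, 1]` with binary expansion `0.w₀w₁w₂…`. -/
def binVal (w : BinSeq) : I := ⟨Real.ofDigits w, Real.ofDigits_nonneg w, Real.ofDigits_le_one w⟩

/-- The word `w` ends in `000…`. -/
def EndsInZeros (w : BinSeq) : Prop := ∃ N, ∀ n ≥ N, w n = 0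

/-- The word `aw`. -/
def consWord (a : Fin 2) (w : BinSeq) : BinSeq
  | 0 => a
  | n + 1 => w n

theorem coe_binVal_shift (w : BinSeq) :
    (binVal w : ℝ) = (w 0 : ℝ) / 2 + (binVal fun i => w (i + 1)) / 2 := by
  have h := Real.ofDigits_eq_sum_add_ofDigits w 1
  simp only [Finset.sum_range_one, Real.ofDigitsTerm] at h
  simp only [binVal]
  rw [h]
  norm_num
  ring

theorem coe_binVal_consWord (a : Fin 2) (w : BinSeq) :
    (binVal (consWord a w) : ℝ) = (a : ℝ) / 2 + binVal w / 2 := by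
  rw [coe_binVal_shift]
  rfl

theorem fin_two_cases (a : Fin 2) : (a = 0 ∧ ((a : ℕ) : ℝ) = 0) ∨ (a = 1 ∧ ((a : ℕ) : ℝ) = 1) := by
  fin_cases a <;> simp

theorem binVal_eq_zero {w : BinSeq} (h : (binVal w : ℝ) = 0) (n : ℕ) : w n = 0 := by
  induction n generalizing w with
  | zero =>
    have h1 := coe_binVal_shift w
    have h2 := (binVal fun i => w (i + 1)).2.1
    rcases fin_two_cases (w 0) with ⟨h3, h4⟩ | ⟨h3, h4⟩
    · exact h3
    · rw [h4] at h1; linarith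
  | succ n ih =>
    have h1 := coe_binVal_shift w
    have h2 := (binVal fun i => w (i + 1)).2.1
    refine ih (w := fun i => w (i + 1)) ?_
    rcases fin_two_cases (w 0) with ⟨h3, h4⟩ | ⟨h3, h4⟩ <;> rw [h4] at h1 <;> linarith

theorem binVal_eq_one {w : BinSeq} (h : (binVal w : ℝ) = 1) (n : ℕ) : w n = 1 := by
  induction n generalizing w with
  | zero =>
    have h1 := coe_binVal_shift w
    have h2 := (binVal fun i => w (i + 1)).2.2
    rcases fin_two_cases (w 0) with ⟨h3, h4⟩ | ⟨h3, h4⟩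
    · rw [h4] at h1; linarith
    · exact h3
  | succ n ih =>
    have h1 := coe_binVal_shift w
    have h2 := (binVal fun i => w (i + 1)).2.2
    refine ih (w := fun i => w (i + 1)) ?_
    rcases fin_two_cases (w 0) with ⟨h3, h4⟩ | ⟨h3, h4⟩ <;> rw [h4] at h1 <;> linarith

theorem endsInZeros_shift_iff (w : BinSeq) (m : ℕ) :
    EndsInZeros (fun i => w (i + m)) ↔ EndsInZeros w := by
  constructor
  · rintro ⟨N, hN⟩
    refine ⟨N + m, fun n hn => ?_⟩
    have : w (n - m + m) = 0 := hN (n - m) (by omega)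
    rwa [Nat.sub_add_cancel (by omega)] at this
  · rintro ⟨N, hN⟩
    exact ⟨N, fun n hn => hN (n + m) (by omega)⟩

theorem endsInZeros_consWord_iff (a : Fin 2) (w : BinSeq) :
    EndsInZeros (consWord a w) ↔ EndsInZeros w :=
  (endsInZeros_shift_iff (consWord a w) 1).symm

/-- Two different expansions of the same number are told apart by `EndsInZeros`. -/
theorem binVal_injective_aux {w v : BinSeq} (h : (binVal w : ℝ) = binVal v)
    (h' : EndsInZeros w ↔ EndsInZeros v) (n : ℕ) : w n = v n := by
  have key : ∀ w v : BinSeq, (binVal w : ℝ) = binVal v → (EndsInZeros w ↔ EndsInZeros v) →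
      w 0 = 0 → w 0 = v 0 := by
    intro w v h h' hw
    by_contra hne
    rcases fin_two_cases (v 0) with ⟨hv, hv'⟩ | ⟨hv, hv'⟩
    · exact hne (hw.trans hv.symm)
    have e1 := coe_binVal_shift w
    have e2 := coe_binVal_shift v
    rw [hw] at e1
    rw [hv'] at e2
    simp only [Fin.val_zero, Nat.cast_zero] at e1
    have b1 := (binVal fun i => w (i + 1)).2.2
    have b2 := (binVal fun i => v (i + 1)).2.1
    have z := binVal_eq_zero (w := fun i => v (i + 1)) (by linarith)
    have o := binVal_eq_one (w := fun i => w (i + 1)) (by linarith)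
    have hv0 : EndsInZeros v := ⟨1, fun n hn => by
      have : v (n - 1 + 1) = 0 := z (n - 1)
      rwa [Nat.sub_add_cancel hn] at this⟩
    obtain ⟨N, hN⟩ := h'.mpr hv0
    have := hN (N + 1) (by omega)
    rw [o N] at this
    exact absurd this (by decide)
  have key2 : ∀ w v : BinSeq, (binVal w : ℝ) = binVal v → (EndsInZeros w ↔ EndsInZeros v) →
      w 0 = v 0 := by
    intro w v h h'
    rcases fin_two_cases (w 0) with ⟨hw, -⟩ | ⟨hw, -⟩
    · exact key w v h h' hw
    · rcases fin_two_cases (v 0) with ⟨hv, -⟩ | ⟨hv, -⟩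
      · exact (key v w h.symm h'.symm hv).symm
      · rw [hw, hv]
  induction n generalizing w v with
  | zero => exact key2 w v h h'
  | succ n ih =>
    have h0 := key2 w v h h'
    have e1 := coe_binVal_shift w
    have e2 := coe_binVal_shift v
    rw [h0] at e1
    refine ih (w := fun i => w (i + 1)) (v := fun i => v (i + 1)) (by linarith) ?_
    rw [endsInZeros_shift_iff w 1, endsInZeros_shift_iff v 1]
    exact h'

theorem binVal_eq_of_endsInZeros {w v : BinSeq} (h : binVal w = binVal v)
    (h' : EndsInZeros w ↔ EndsInZeros v) : w = v :=
  funext (binVal_injective_aux (congrArg Subtype.val h) h')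

theorem EndsInZeros.isDyadic {w : BinSeq} (h : EndsInZeros w) : IsDyadic (binVal w) := by
  obtain ⟨N, hN⟩ := h
  induction N generalizing w with
  | zero =>
    have : w = fun _ => 0 := funext fun n => hN n (by omega)
    subst this
    have : (binVal (fun _ => 0) : ℝ) = 0 := by
      simp [binVal, Real.ofDigits, Real.ofDigitsTerm]
    rw [this]
    exact IsDyadic.zero
  | succ N ih =>
    rw [coe_binVal_shift]
    have h1 := ih (w := fun i => w (i + 1)) (fun n hn => hN (n + 1) (by omega))
    have h2 : IsDyadic ((w 0 : ℕ) : ℝ) := ⟨(w 0 : ℕ), 0, by simp⟩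
    have h3 : IsDyadic (1 / 2) := ⟨1, 1, by norm_num⟩
    have := (h2.mul h3).add (h1.mul h3)
    convert this using 1
    ring

theorem EndsInZeros.lt_one {w : BinSeq} (h : EndsInZeros w) : (binVal w : ℝ) < 1 := by
  refine lt_of_le_of_ne (binVal w).2.2 fun h1 => ?_
  obtain ⟨N, hN⟩ := h
  have := hN N le_rfl
  rw [binVal_eq_one h1 N] at this
  exact absurd this (by decide)

theorem exists_endsInZeros {t : I} (ht : IsDyadic t) (h1 : (t : ℝ) < 1) :
    ∃ w, binVal w = t ∧ EndsInZeros w := by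
  refine ⟨Real.digits t 2, Subtype.ext (Real.ofDigits_digits (by norm_num) ⟨t.2.1, h1⟩), ?_⟩
  obtain ⟨k, n, hk⟩ := ht
  have hk0 : 0 ≤ k := by
    have h0 := t.2.1
    rw [hk] at h0
    by_contra hneg
    have : (k : ℝ) < 0 := by exact_mod_cast not_le.mp hneg
    have : (k : ℝ) / 2 ^ n < 0 := div_neg_of_neg_of_pos this (by positivity)
    linarith
  obtain ⟨m, rfl⟩ := Int.eq_ofNat_of_zero_le hk0
  refine ⟨n, fun i hi => ?_⟩
  obtain ⟨j, rfl⟩ := Nat.exists_eq_add_of_le hi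
  have : (t : ℝ) * (2 : ℕ) ^ (n + j + 1) = ((2 * (m * 2 ^ j) : ℕ) : ℝ) := by
    rw [hk]
    push_cast
    field_simp
    ring
  simp only [Real.digits]
  rw [this, Nat.floor_natCast]
  apply Fin.ext
  simp [Fin.ofNat]

theorem exists_not_endsInZeros {t : I} (h0 : 0 < (t : ℝ)) :
    ∃ w, binVal w = t ∧ ¬ EndsInZeros w := by
  have key : ∀ (N : ℕ) (w : BinSeq), (∀ n ≥ N, w n = 0) → 0 < (binVal w : ℝ) →
      ∃ v, (binVal v : ℝ) = binVal w ∧ ¬ EndsInZeros v := by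
    intro N
    induction N with
    | zero =>
      intro w hw h0
      have : w = fun _ => 0 := funext fun n => hw n (by omega)
      subst this
      simp [binVal, Real.ofDigits, Real.ofDigitsTerm] at h0
    | succ N ih =>
      intro w hw h0
      have e := coe_binVal_shift w
      rcases ((binVal fun i => w (i + 1)).2.1).eq_or_lt with hz | hz
      · refine ⟨consWord 0 fun _ => 1, ?_, ?_⟩
        · rw [coe_binVal_consWord]
          have h1 : (binVal (fun _ => 1) : ℝ) = 1 := Real.ofDigits_const_last_eq_one 1
          rw [h1, e, ← hz]
          rcases fin_two_cases (w 0) with ⟨-, h4⟩ | ⟨-, h4⟩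
          · rw [h4, ← hz] at e; linarith
          · rw [h4]; simp
        · rw [endsInZeros_consWord_iff]
          rintro ⟨M, hM⟩
          exact absurd (hM M le_rfl : (1 : Fin 2) = 0) Fin.zero_ne_one.symm
      · obtain ⟨v, hv, hv'⟩ := ih (fun i => w (i + 1)) (fun n hn => hw (n + 1) (by omega)) hz
        refine ⟨consWord (w 0) v, ?_, ?_⟩
        · rw [coe_binVal_consWord, hv, e]
        · rwa [endsInZeros_consWord_iff]
  obtain ⟨w, -, hw⟩ := Real.ofDigits_SurjOn (b := 2) (by norm_num) t.2
  have hw' : binVal w = t := Subtype.ext hw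
  by_cases h : EndsInZeros w
  · obtain ⟨N, hN⟩ := h
    obtain ⟨v, hv, hv'⟩ := key N w hN (by rw [hw']; exact h0)
    exact ⟨v, by rw [← hw']; exact Subtype.ext hv, hv'⟩
  · exact ⟨w, hw', h⟩

theorem existsUnique_cantorImage (f : ThompsonF) (w : BinSeq) :
    ∃! v : BinSeq, binVal v = f • binVal w ∧ (EndsInZeros v ↔ EndsInZeros w) := by
  have hf0 := strictMono_homeomorph_zero f.1 f.2.1
  refine existsUnique_of_exists_of_unique ?_ ?_
  · by_cases h : EndsInZeros w
    · obtain ⟨v, hv, hv'⟩ := exists_endsInZeros (t := f • binVal w)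
        (f.2.2.isDyadic_apply hf0 h.isDyadic) (by
          have h1 : binVal w < 1 := h.lt_one
          have h2 : ((f.1 (binVal w) : I) : ℝ) < (f.1 1 : I) := f.2.1 h1
          exact h2.trans_le (f.1 1).2.2)
      exact ⟨v, hv, by simp [h, hv']⟩
    · have h0 : (0 : I) < binVal w := by
        refine lt_of_le_of_ne unitInterval.nonneg' fun h0 => h ⟨0, fun n _ => ?_⟩
        exact binVal_eq_zero (by rw [← h0]; rfl) n
      obtain ⟨v, hv, hv'⟩ := exists_not_endsInZeros (t := f • binVal w) (by
        have := f.2.1 h0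
        rw [hf0] at this
        exact this)
      exact ⟨v, hv, by simp [h, hv']⟩
  · rintro v v' ⟨h1, h2⟩ ⟨h3, h4⟩
    exact binVal_eq_of_endsInZeros (h1.trans h3.symm) (h2.trans h4.symm)

/-- The standard action of `F` on the Cantor set, induced by the action on `[0, 1]` through binary
expansions: `f • w` is the binary expansion of `f (0.w)`, where of the two expansions of a dyadic
rational in `(0, 1)` the one ending in `000…` is chosen if and only if `w` ends in `000…`. -/
instance standardAction : MulAction ThompsonF BinSeq where
  smul f w := (existsUnique_cantorImage f w).choose
  one_smul w := ((existsUnique_cantorImage 1 w).choose_spec.2 w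
    ⟨(one_smul ThompsonF (binVal w)).symm, Iff.rfl⟩).symm
  mul_smul f g w := by
    have h1 := (existsUnique_cantorImage g w).choose_spec.1
    have h2 := (existsUnique_cantorImage f (existsUnique_cantorImage g w).choose).choose_spec.1
    exact ((existsUnique_cantorImage (f * g) w).choose_spec.2 _
      ⟨h2.1.trans (congrArg (f • ·) h1.1), h2.2.trans h1.2⟩).symm

theorem cantor_smul_spec (f : ThompsonF) (w : BinSeq) :
    binVal (f • w) = f • binVal w ∧ (EndsInZeros (f • w) ↔ EndsInZeros w) :=
  (existsUnique_cantorImage f w).choose_spec.1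

theorem cantor_smul_eq_of {f : ThompsonF} {w v : BinSeq} (h : binVal v = f • binVal w)
    (h' : EndsInZeros v ↔ EndsInZeros w) : f • w = v :=
  ((existsUnique_cantorImage f w).choose_spec.2 v ⟨h, h'⟩).symm

/-- The generator `x₀` acts by `0w ↦ 00w`, `10w ↦ 01w`, `11w ↦ 1w`. -/
theorem x₀_smul_word (w : BinSeq) :
    x₀ • consWord 0 w = consWord 0 (consWord 0 w) ∧
    x₀ • consWord 1 (consWord 0 w) = consWord 0 (consWord 1 w) ∧
    x₀ • consWord 1 (consWord 1 w) = consWord 1 w := by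
  have h0 := (binVal w).2.1
  have h1 := (binVal w).2.2
  refine ⟨?_, ?_, ?_⟩ <;>
  · refine cantor_smul_eq_of (Subtype.ext ?_) (by simp only [endsInZeros_consWord_iff])
    rw [coe_x₀_smul]
    simp only [coe_binVal_consWord, x₀Fun, Fin.val_zero, Fin.val_one, Nat.cast_zero, Nat.cast_one]
    split_ifs <;> linarith

/-- The generator `x₁` acts by `0w ↦ 0w`, `10w ↦ 100w`, `110w ↦ 101w`, `111w ↦ 11w`. -/
theorem x₁_smul_word (w : BinSeq) :
    x₁ • consWord 0 w = consWord 0 w ∧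
    x₁ • consWord 1 (consWord 0 w) = consWord 1 (consWord 0 (consWord 0 w)) ∧
    x₁ • consWord 1 (consWord 1 (consWord 0 w)) = consWord 1 (consWord 0 (consWord 1 w)) ∧
    x₁ • consWord 1 (consWord 1 (consWord 1 w)) = consWord 1 (consWord 1 w) := by
  have h0 := (binVal w).2.1
  have h1 := (binVal w).2.2
  refine ⟨?_, ?_, ?_, ?_⟩ <;>
  · refine cantor_smul_eq_of (Subtype.ext ?_) (by simp only [endsInZeros_consWord_iff])
    rw [coe_x₁_smul]
    simp only [coe_binVal_consWord, x₁Fun, Fin.val_zero, Fin.val_one, Nat.cast_zero, Nat.cast_one]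
    split_ifs <;> linarith

/-! ### The space of pointed marked graphs -/

/-- A regular marked pointed graph with labels in `S`: every vertex has, for every label `s`,
exactly one outgoing and exactly one incoming arrow labeled by `s`. There is an arrow labeled by
`s` from `u` to `v` if and only if `step s u = v`. -/
structure MarkedGraph (S : Type) where
  V : Type
  step : S → Equiv.Perm V
  base : V

namespace MarkedGraph

variable {S : Type}

/-- The vertices at distance at most `n` from the base vertex (arrows may be traversed in both
directions). -/
def ball (Γ : MarkedGraph S) : ℕ → Set Γ.V
  | 0 => {Γ.base}
  | n + 1 => {v | v ∈ ball Γ n ∨ ∃ u ∈ ball Γ n, ∃ s, Γ.step s u = v ∨ Γ.step s v = u}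

/-- The connected component of the base vertex. -/
def component (Γ : MarkedGraph S) : Set Γ.V := ⋃ n, Γ.ball n

/-- The subgraphs induced on `A` and `B` are isomorphic as marked pointed graphs. -/
def InducedIso (Γ Δ : MarkedGraph S) (A : Set Γ.V) (B : Set Δ.V) : Prop :=
  ∃ e : A ≃ B, (∀ a : A, (a : Γ.V) = Γ.base ↔ (e a : Δ.V) = Δ.base) ∧
    ∀ (s : S) (a b : A), Γ.step s a = b ↔ Δ.step s (e a) = e b

theorem InducedIso.refl (Γ : MarkedGraph S) (A : Set Γ.V) : InducedIso Γ Γ A A :=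
  ⟨Equiv.refl _, fun _ => Iff.rfl, fun _ _ _ => Iff.rfl⟩

theorem InducedIso.symm {Γ Δ : MarkedGraph S} {A : Set Γ.V} {B : Set Δ.V}
    (h : InducedIso Γ Δ A B) : InducedIso Δ Γ B A := by
  obtain ⟨e, h1, h2⟩ := h
  exact ⟨e.symm, fun a => by simpa using (h1 (e.symm a)).symm,
    fun s a b => by simpa using (h2 s (e.symm a) (e.symm b)).symm⟩

theorem InducedIso.trans {Γ Δ Θ : MarkedGraph S} {A : Set Γ.V} {B : Set Δ.V} {C : Set Θ.V}
    (h : InducedIso Γ Δ A B) (h' : InducedIso Δ Θ B C) : InducedIso Γ Θ A C := by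
  obtain ⟨e, h1, h2⟩ := h
  obtain ⟨e', h1', h2'⟩ := h'
  exact ⟨e.trans e', fun a => (h1 a).trans (h1' (e a)),
    fun s a b => (h2 s a b).trans (h2' s (e a) (e b))⟩

/-- The balls of radius `n` around the base vertices are isomorphic as marked pointed graphs. -/
def BallIso (n : ℕ) (Γ Δ : MarkedGraph S) : Prop := InducedIso Γ Δ (Γ.ball n) (Δ.ball n)

theorem ball_subset_succ (Γ : MarkedGraph S) (n : ℕ) : Γ.ball n ⊆ Γ.ball (n + 1) :=
  fun _ h => Or.inl h

theorem ball_mono (Γ : MarkedGraph S) : Monotone Γ.ball :=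
  monotone_nat_of_le_succ Γ.ball_subset_succ

theorem base_mem_ball (Γ : MarkedGraph S) (n : ℕ) : Γ.base ∈ Γ.ball n :=
  Γ.ball_mono (Nat.zero_le n) rfl

theorem BallIso.mono {m n : ℕ} (hmn : m ≤ n) {Γ Δ : MarkedGraph S} (h : BallIso n Γ Δ) :
    BallIso m Γ Δ := by
  have fwd : ∀ {Γ Δ : MarkedGraph S} (e : Γ.ball n ≃ Δ.ball n),
      (∀ a : Γ.ball n, (a : Γ.V) = Γ.base ↔ (e a : Δ.V) = Δ.base) →
      (∀ (s : S) (a b : Γ.ball n), Γ.step s a = b ↔ Δ.step s (e a) = e b) →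
      ∀ k ≤ n, ∀ a : Γ.ball n, (a : Γ.V) ∈ Γ.ball k → (e a : Δ.V) ∈ Δ.ball k := by
    intro Γ Δ e h1 h2 k
    induction k with
    | zero => intro _ a ha; exact (h1 a).mp ha
    | succ k ih =>
      rintro hk a (ha | ⟨u, hu, s, hs⟩)
      · exact Or.inl (ih (by omega) a ha)
      · have hu' : u ∈ Γ.ball n := Γ.ball_mono (by omega) hu
        exact Or.inr ⟨e ⟨u, hu'⟩, ih (by omega) ⟨u, hu'⟩ hu, s,
          hs.imp (h2 s ⟨u, hu'⟩ a).mp (h2 s a ⟨u, hu'⟩).mp⟩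
  obtain ⟨e, h1, h2⟩ := h
  have h1' : ∀ b : Δ.ball n, (b : Δ.V) = Δ.base ↔ (e.symm b : Γ.V) = Γ.base :=
    fun b => by simpa using (h1 (e.symm b)).symm
  have h2' : ∀ (s : S) (a b : Δ.ball n),
      Δ.step s a = b ↔ Γ.step s (e.symm a) = e.symm b :=
    fun s a b => by simpa using (h2 s (e.symm a) (e.symm b)).symm
  refine ⟨⟨fun a => ⟨e ⟨a, Γ.ball_mono hmn a.2⟩, fwd e h1 h2 m hmn _ a.2⟩,
    fun b => ⟨e.symm ⟨b, Δ.ball_mono hmn b.2⟩, fwd e.symm h1' h2' m hmn _ b.2⟩,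
    fun a => ?_, fun b => ?_⟩, fun a => h1 ⟨a, Γ.ball_mono hmn a.2⟩,
    fun s a b => h2 s ⟨a, Γ.ball_mono hmn a.2⟩ ⟨b, Γ.ball_mono hmn b.2⟩⟩
  · simp
  · simp

/-- The topology of the metric `d(Γ, Δ) = 2⁻ⁿ`, where `n` is the largest integer for which the
balls of radius `n` around the base vertices are isomorphic. -/
instance : TopologicalSpace (MarkedGraph S) where
  IsOpen U := ∀ Γ ∈ U, ∃ n, ∀ Δ, BallIso n Γ Δ → Δ ∈ U
  isOpen_univ := fun _ _ => ⟨0, fun _ _ => trivial⟩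
  isOpen_inter := by
    rintro U W hU hW Γ ⟨hΓU, hΓW⟩
    obtain ⟨n, hn⟩ := hU Γ hΓU
    obtain ⟨m, hm⟩ := hW Γ hΓW
    exact ⟨max n m, fun Δ hΔ =>
      ⟨hn Δ (hΔ.mono (le_max_left _ _)), hm Δ (hΔ.mono (le_max_right _ _))⟩⟩
  isOpen_sUnion := by
    rintro 𝒰 h𝒰 Γ ⟨U, hU, hΓ⟩
    obtain ⟨n, hn⟩ := h𝒰 U hU Γ hΓ
    exact ⟨n, fun Δ hΔ => ⟨U, hU, hn Δ hΔ⟩⟩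

/-- Isomorphism of the connected components of the base vertices. -/
instance isoSetoid (S : Type) : Setoid (MarkedGraph S) where
  r Γ Δ := InducedIso Γ Δ Γ.component Δ.component
  iseqv := ⟨fun Γ => InducedIso.refl Γ _, InducedIso.symm, InducedIso.trans⟩

end MarkedGraph

/-- The space of connected regular marked pointed graphs up to isomorphism (a marked pointed graph
stands for the connected component of its base vertex), with the topology in which two graphs are
close if they have isomorphic balls of large radius centered at the base vertices. -/
abbrev GraphSpace (S : Type) : Type 1 := Quotient (MarkedGraph.isoSetoid S)

/-! ### Schreier graphs and Schreier dynamical systems -/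

/-- The Schreier graph of the action of `G` on the orbit of `y` with respect to the family `gen`
of elements of `G`, with base vertex `y`: there is an arrow labeled by `s` from `u` to
`gen s • u`. -/
def orbitalSchreierGraph {G M S : Type} [Group G] [MulAction G M] (gen : S → G) (y : M) :
    MarkedGraph S where
  V := MulAction.orbit G y
  step s := MulAction.toPerm (gen s)
  base := ⟨y, MulAction.mem_orbit_self y⟩

/-- The pointed Schreier graph `Γ_y` of a point `y` of `[0, 1]` with respect to the generators
`x₀`, `x₁` of Thompson's group `F`. -/
def schreierGraph (y : I) : GraphSpace (Fin 2) := ⟦orbitalSchreierGraph ![x₀, x₁] y⟧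

/-- The family `𝒞_x` of the pointed Schreier graphs `Γ_y` of the points `y` of the orbit of `x`. -/
def schreierFamily (x : I) : Set (GraphSpace (Fin 2)) :=
  schreierGraph '' MulAction.orbit ThompsonF x

theorem schreierGraph_mem_closure {x y : I} (hy : y ∈ MulAction.orbit ThompsonF x) :
    schreierGraph y ∈ closure (schreierFamily x) :=
  subset_closure (mem_image_of_mem _ hy)

/-- `α` is the Schreier dynamical system of the orbit of `x`: an action of `F` by homeomorphisms on
the closure of `𝒞_x` which on `𝒞_x` itself shifts the base vertex, that is, `f` takes the Schreier
graph with base vertex `y` to the same graph with base vertex `f y`. -/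
def IsSchreierSystem (x : I)
    (α : ThompsonF →* (closure (schreierFamily x) ≃ₜ closure (schreierFamily x))) : Prop :=
  ∀ (f : ThompsonF) (y : I) (hy : y ∈ MulAction.orbit ThompsonF x),
    (α f ⟨schreierGraph y, schreierGraph_mem_closure hy⟩ : GraphSpace (Fin 2)) =
      schreierGraph (f • y)

/-- The set `𝒟`: the perfect kernel of the closure of the family of pointed Schreier graphs of the
dyadic rationals in `(0, 1)` (the orbit of `1 / 2`). -/
def dyadicKernel : Set (GraphSpace (Fin 2)) :=
  CantorBendixson.perfectKernel
    (closure (schreierFamily ⟨1 / 2, by norm_num, by norm_num⟩))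

end

/-! ### Marked graphs and words -/

/-! A pointed graph with arrows labeled by `S` is determined up to isomorphism by the set of words
in the free group on `S` that close up at the base vertex. For finite `S`, a ball is decided by
finitely many words, so `GraphSpace S` embeds into the product `FreeGroup S → Bool`
(`GraphSpace.isEmbedding_closedWords`). Under this embedding `Γ_y` becomes the stabilizer of `y`,
pulled back to words, and the question is how stabilizers accumulate.

Every element of `F` locally replaces one finite prefix by another. Hence near any infinite word `w`
it is either the identity or has no fixed point other than possibly `w`
(`eventually_smul_eq_or_ne`). So, as `v → w` with `v ≠ w`, the stabilizer of `v` converges to the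
group of elements that are the identity near `w`. Its Schreier graph is `germGraph w`, and this
limit does not depend on `x`. By compactness of the Cantor set every accumulation point of `𝒞_x` is
such a graph (`derivedSet_schreierFamily_subset`). For `x` in `(0, 1)` the words of the orbit
accumulate at every `w`, so every germ graph occurs.

The map `germGraph` is continuous. It is injective because `x₁` is the identity near `w` exactly
when `w` starts with `0`, and elements of `F` can move two distinct words so that their first
letters differ; that `x₀` and `x₁` generate `F` lets the graph recover the whole germ stabilizer.
Thus `germGraph` is a closed embedding of the Cantor set, its image is perfect, and this image is
the perfect kernel for every `x`. The conjugacy `ψ` is its inverse. Words move base vertices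
continuously, which gives the action on the closure, and passing to the limit in `Γ_v ↦ Γ_{f v}`
gives equivariance. -/

namespace MarkedGraph

variable {S : Type}

/-- The action of words on the vertices of a marked graph. -/
def wordPerm (Γ : MarkedGraph S) : FreeGroup S →* Equiv.Perm Γ.V := FreeGroup.lift Γ.step

theorem wordPerm_of_mul (Γ : MarkedGraph S) (s : S) (g : FreeGroup S) (v : Γ.V) :
    Γ.wordPerm (FreeGroup.of s * g) v = Γ.step s (Γ.wordPerm g v) := by
  simp [wordPerm]

theorem step_wordPerm_of_inv_mul (Γ : MarkedGraph S) (s : S) (g : FreeGroup S) (v : Γ.V) :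
    Γ.step s (Γ.wordPerm ((FreeGroup.of s)⁻¹ * g) v) = Γ.wordPerm g v := by
  simp [wordPerm]

theorem wordPerm_inv_mul_apply_eq_iff (Γ : MarkedGraph S) (g h : FreeGroup S) (v : Γ.V) :
    Γ.wordPerm (h⁻¹ * g) v = v ↔ Γ.wordPerm g v = Γ.wordPerm h v := by
  rw [map_mul, map_inv, Equiv.Perm.mul_apply, Equiv.Perm.inv_eq_iff_eq]

/-- The words of length at most `n`. -/
def wordBall (S : Type) : ℕ → Set (FreeGroup S)
  | 0 => {1}
  | n + 1 => {g | g ∈ wordBall S n ∨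
      ∃ h ∈ wordBall S n, ∃ s, g = FreeGroup.of s * h ∨ g = (FreeGroup.of s)⁻¹ * h}

theorem finite_wordBall [Finite S] (n : ℕ) : (wordBall S n).Finite := by
  induction n with
  | zero => exact finite_singleton 1
  | succ n ih =>
    refine (ih.union ((finite_iUnion fun s : S => ih.image (FreeGroup.of s * ·)).union
      (finite_iUnion fun s : S => ih.image ((FreeGroup.of s)⁻¹ * ·)))).subset ?_
    rintro g (hg | ⟨h, hh, s, rfl | rfl⟩)
    · exact Or.inl hg
    · exact Or.inr (Or.inl (mem_iUnion.mpr ⟨s, h, hh, rfl⟩))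
    · exact Or.inr (Or.inr (mem_iUnion.mpr ⟨s, h, hh, rfl⟩))

theorem one_mem_wordBall (n : ℕ) : (1 : FreeGroup S) ∈ wordBall S n := by
  induction n with
  | zero => rfl
  | succ n ih => exact Or.inl ih

theorem exists_mem_wordBall (g : FreeGroup S) : ∃ n, g ∈ wordBall S n := by
  suffices H : ∀ h, (∃ n, h ∈ wordBall S n) → ∃ n, g * h ∈ wordBall S n by
    simpa using H 1 ⟨0, rfl⟩
  induction g using FreeGroup.induction_on with
  | C1 => simp
  | of s => exact fun h ⟨n, hn⟩ => ⟨n + 1, Or.inr ⟨h, hn, s, Or.inl rfl⟩⟩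
  | inv_of s _ => exact fun h ⟨n, hn⟩ => ⟨n + 1, Or.inr ⟨h, hn, s, Or.inr rfl⟩⟩
  | mul a b ha hb => exact fun h hh => by rw [mul_assoc]; exact ha _ (hb _ hh)

/-- The vertices reached from the base vertex along the words of `W`. -/
def reach (Γ : MarkedGraph S) (W : Set (FreeGroup S)) : Set Γ.V :=
  (fun g => Γ.wordPerm g Γ.base) '' W

theorem ball_eq_reach (Γ : MarkedGraph S) (n : ℕ) : Γ.ball n = Γ.reach (wordBall S n) := by
  induction n with
  | zero => simp [ball, wordBall, reach]
  | succ n ih =>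
    ext v
    constructor
    · rintro (hv | ⟨u, hu, s, hs⟩)
      · rw [ih] at hv
        obtain ⟨g, hg, rfl⟩ := hv
        exact ⟨g, Or.inl hg, rfl⟩
      · rw [ih] at hu
        obtain ⟨g, hg, rfl⟩ := hu
        rcases hs with rfl | hs
        · exact ⟨FreeGroup.of s * g, Or.inr ⟨g, hg, s, Or.inl rfl⟩, Γ.wordPerm_of_mul s g _⟩
        · refine ⟨(FreeGroup.of s)⁻¹ * g, Or.inr ⟨g, hg, s, Or.inr rfl⟩, ?_⟩
          apply (Γ.step s).injective
          exact (Γ.step_wordPerm_of_inv_mul s g _).trans hs.symm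
    · rintro ⟨g, hg | ⟨h, hh, s, rfl | rfl⟩, rfl⟩
      · exact Or.inl (ih ▸ ⟨g, hg, rfl⟩)
      · exact Or.inr ⟨_, ih ▸ ⟨h, hh, rfl⟩, s, Or.inl (Γ.wordPerm_of_mul s h _).symm⟩
      · exact Or.inr ⟨_, ih ▸ ⟨h, hh, rfl⟩, s, Or.inr (Γ.step_wordPerm_of_inv_mul s h _)⟩

theorem component_eq_reach (Γ : MarkedGraph S) : Γ.component = Γ.reach univ := by
  ext v
  simp only [component, mem_iUnion, ball_eq_reach]
  constructor
  · rintro ⟨n, g, -, rfl⟩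
    exact ⟨g, trivial, rfl⟩
  · rintro ⟨g, -, rfl⟩
    obtain ⟨n, hn⟩ := exists_mem_wordBall g
    exact ⟨n, g, hn, rfl⟩

/-- The word `g` describes a closed path at the base vertex. -/
def FixesBase (Γ : MarkedGraph S) (g : FreeGroup S) : Prop := Γ.wordPerm g Γ.base = Γ.base

/-- Two words end at the same vertex iff their quotient is closed, and an arrow between two
endpoints is likewise a closed word. So send each vertex to the endpoint, in the other graph, of a
word of `W` leading to it: `hW` makes this independent of the word and bijective, and `hS` makes it
respect arrows. -/
theorem inducedIso_reach {Γ Δ : MarkedGraph S} {W : Set (FreeGroup S)} (h1 : 1 ∈ W)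
    (hW : ∀ g ∈ W, ∀ h ∈ W, Γ.FixesBase (h⁻¹ * g) ↔ Δ.FixesBase (h⁻¹ * g))
    (hS : ∀ s, ∀ g ∈ W, ∀ h ∈ W, Γ.FixesBase (h⁻¹ * (FreeGroup.of s * g)) ↔
      Δ.FixesBase (h⁻¹ * (FreeGroup.of s * g))) :
    InducedIso Γ Δ (Γ.reach W) (Δ.reach W) := by
  simp only [FixesBase, wordPerm_inv_mul_apply_eq_iff, wordPerm_of_mul] at hW hS
  have hc : ∀ a : Γ.reach W, ∃ g ∈ W, Γ.wordPerm g Γ.base = a := fun a => a.2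
  choose w hw hwa using hc
  have hbij : Function.Bijective
      (fun a => ⟨Δ.wordPerm (w a) Δ.base, w a, hw a, rfl⟩ : Γ.reach W → Δ.reach W) := by
    constructor
    · intro a b hab
      have := (hW _ (hw a) _ (hw b)).mpr (congrArg Subtype.val hab)
      rw [hwa, hwa] at this
      exact Subtype.ext this
    · rintro ⟨_, g, hg, rfl⟩
      refine ⟨⟨Γ.wordPerm g Γ.base, g, hg, rfl⟩, Subtype.ext ?_⟩
      exact (hW _ (hw _) _ hg).mp (hwa _)
  refine ⟨Equiv.ofBijective _ hbij, fun a => ?_, fun s a b => ?_⟩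
  · have := hW _ (hw a) 1 h1
    rw [hwa] at this
    simpa using this
  · have := hS s _ (hw a) _ (hw b)
    rw [hwa, hwa] at this
    exact this

/-- An isomorphism of induced subgraphs carries the endpoint of a word to the endpoint of the same
word, by induction on length, as long as the path stays inside `A`. -/
theorem InducedIso.fixesBase_iff {Γ Δ : MarkedGraph S} {A : Set Γ.V} {B : Set Δ.V}
    (h : InducedIso Γ Δ A B) {n : ℕ} (hn : Γ.ball n ⊆ A) {g : FreeGroup S}
    (hg : g ∈ wordBall S n) : Γ.FixesBase g ↔ Δ.FixesBase g := by
  obtain ⟨e, he, hs⟩ := h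
  have key : ∀ m ≤ n, ∀ g ∈ wordBall S m, ∃ ha : Γ.wordPerm g Γ.base ∈ A,
      (e ⟨_, ha⟩ : Δ.V) = Δ.wordPerm g Δ.base := by
    intro m
    induction m with
    | zero =>
      rintro - g rfl
      have hb : Γ.base ∈ A := hn (Γ.base_mem_ball n)
      refine ⟨by simpa using hb, ?_⟩
      simpa using (he ⟨Γ.base, hb⟩).mp rfl
    | succ m ih =>
      intro hm g hg
      have hmem : Γ.wordPerm g Γ.base ∈ A :=
        hn (Γ.ball_mono hm (Γ.ball_eq_reach _ ▸ ⟨g, hg, rfl⟩))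
      refine ⟨hmem, ?_⟩
      rcases hg with hg | ⟨h, hh, s, rfl | rfl⟩
      · exact (ih (by omega) g hg).2
      · obtain ⟨ha, hea⟩ := ih (by omega) h hh
        rw [Δ.wordPerm_of_mul, ← hea]
        exact ((hs s ⟨_, ha⟩ ⟨_, hmem⟩).mp (Γ.wordPerm_of_mul s h _).symm).symm
      · obtain ⟨ha, hea⟩ := ih (by omega) h hh
        apply (Δ.step s).injective
        rw [step_wordPerm_of_inv_mul, ← hea]
        exact (hs s ⟨_, hmem⟩ ⟨_, ha⟩).mp (Γ.step_wordPerm_of_inv_mul s h _)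
  obtain ⟨ha, hea⟩ := key n le_rfl g hg
  rw [FixesBase, FixesBase, ← hea]
  exact he ⟨_, ha⟩

theorem equiv_iff {Γ Δ : MarkedGraph S} : Γ ≈ Δ ↔ ∀ g, Γ.FixesBase g ↔ Δ.FixesBase g := by
  constructor
  · intro h g
    obtain ⟨n, hn⟩ := exists_mem_wordBall g
    exact InducedIso.fixesBase_iff h (subset_iUnion _ n) hn
  · intro h
    change InducedIso Γ Δ Γ.component Δ.component
    rw [component_eq_reach, component_eq_reach]
    exact inducedIso_reach trivial (fun _ _ _ _ => h _) (fun _ _ _ _ _ => h _)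

open Classical in
/-- The indicator function of the set of words that fix the base vertex. -/
noncomputable def closedWords (Γ : MarkedGraph S) (g : FreeGroup S) : Bool :=
  decide (Γ.FixesBase g)

theorem closedWords_eq_iff {Γ Δ : MarkedGraph S} {g : FreeGroup S} :
    Γ.closedWords g = Δ.closedWords g ↔ (Γ.FixesBase g ↔ Δ.FixesBase g) := by
  simp [closedWords]

theorem isInducing_closedWords [Finite S] :
    IsInducing (closedWords : MarkedGraph S → FreeGroup S → Bool) := by
  rw [isInducing_iff_nhds]
  intro Γ
  have hopen : ∀ n, IsOpen {Δ | BallIso n Γ Δ} := fun n Δ hΔ =>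
    ⟨n, fun _ h => InducedIso.trans hΔ h⟩
  apply le_antisymm
  · rw [← Filter.map_le_iff_le_comap]
    change Filter.Tendsto _ _ _
    rw [tendsto_pi_nhds]
    intro g
    rw [nhds_discrete Bool, Filter.tendsto_pure]
    obtain ⟨n, hn⟩ := exists_mem_wordBall g
    filter_upwards [(hopen n).mem_nhds (InducedIso.refl Γ _)] with Δ hΔ
    exact closedWords_eq_iff.mpr (InducedIso.fixesBase_iff hΔ subset_rfl hn).symm
  · intro U hU
    obtain ⟨V, hVU, hV, hΓV⟩ := mem_nhds_iff.mp hU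
    obtain ⟨n, hn⟩ := hV Γ hΓV
    have hfin := finite_wordBall (S := S) n
    -- These finitely many words decide equality of endpoints and presence of arrows inside the
    -- ball, hence its isomorphism type.
    have hfin' : (image2 (fun h g => h⁻¹ * g) (wordBall S n) (wordBall S n) ∪
        ⋃ s : S, image2 (fun h g => h⁻¹ * (FreeGroup.of s * g)) (wordBall S n)
          (wordBall S n)).Finite :=
      (hfin.image2 _ hfin).union (finite_iUnion fun _ => hfin.image2 _ hfin)
    refine Filter.mem_of_superset (Filter.preimage_mem_comap
      (set_pi_mem_nhds hfin' (s := fun g => {Γ.closedWords g})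
        fun g _ => mem_nhds_discrete.mpr rfl)) fun Δ hΔ => hVU (hn Δ ?_)
    have hΔ' : ∀ g ∈ _, Δ.closedWords g = Γ.closedWords g := hΔ
    rw [BallIso, ball_eq_reach, ball_eq_reach]
    refine inducedIso_reach (one_mem_wordBall n)
      (fun g hg h hh => (closedWords_eq_iff.mp (hΔ' _ (Or.inl ⟨h, hh, g, hg, rfl⟩))).symm)
      (fun s g hg h hh => (closedWords_eq_iff.mp (hΔ' _ (Or.inr ?_))).symm)
    exact mem_iUnion.mpr ⟨s, h, hh, g, hg, rfl⟩

/-- The graph with the base vertex moved along a word. -/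
def shift (g : FreeGroup S) (Γ : MarkedGraph S) : MarkedGraph S where
  V := Γ.V
  step := Γ.step
  base := Γ.wordPerm g Γ.base

theorem fixesBase_shift (g h : FreeGroup S) (Γ : MarkedGraph S) :
    (Γ.shift g).FixesBase h ↔ Γ.FixesBase (g⁻¹ * h * g) := by
  rw [FixesBase, mul_assoc, FixesBase, wordPerm_inv_mul_apply_eq_iff, map_mul]
  rfl

end MarkedGraph

/-! ### Isomorphism classes of graphs and the action of words on them -/

namespace GraphSpace

variable {S : Type}

/-- The word `g` describes a closed path at the base vertex. -/
def FixesBase (Γ : GraphSpace S) (g : FreeGroup S) : Prop :=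
  Quotient.liftOn Γ (fun Γ => Γ.FixesBase g) fun _ _ h => propext (MarkedGraph.equiv_iff.mp h g)

@[ext]
theorem ext {Γ Δ : GraphSpace S} (h : ∀ g, Γ.FixesBase g ↔ Δ.FixesBase g) : Γ = Δ := by
  induction Γ using Quotient.inductionOn
  induction Δ using Quotient.inductionOn
  exact Quotient.sound (MarkedGraph.equiv_iff.mpr h)

open Classical in
/-- The indicator function of the set of words that fix the base vertex. -/
noncomputable def closedWords (Γ : GraphSpace S) (g : FreeGroup S) : Bool :=
  decide (Γ.FixesBase g)

theorem closedWords_eq_iff {Γ Δ : GraphSpace S} {g : FreeGroup S} :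
    Γ.closedWords g = Δ.closedWords g ↔ (Γ.FixesBase g ↔ Δ.FixesBase g) := by
  simp [closedWords]

theorem isEmbedding_closedWords [Finite S] :
    IsEmbedding (closedWords : GraphSpace S → FreeGroup S → Bool) := by
  refine ⟨⟨TopologicalSpace.ext_iff.mpr fun U => ?_⟩, fun Γ Δ h => ?_⟩
  · rw [isOpen_induced_iff, ← isQuotientMap_quotient_mk'.isOpen_preimage,
      MarkedGraph.isInducing_closedWords.isOpen_iff]
    refine exists_congr fun W => and_congr_right fun _ => ?_
    constructor
    · intro h
      apply Quotient.mk_surjective.preimage_injective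
      exact h
    · rintro rfl
      rfl
  · ext g
    exact closedWords_eq_iff.mp (congrFun h g)

instance [Finite S] : T2Space (GraphSpace S) := isEmbedding_closedWords.t2Space

theorem tendsto_nhds_iff [Finite S] {X : Type*} {l : Filter X} {u : X → GraphSpace S}
    {Γ : GraphSpace S} : Filter.Tendsto u l (𝓝 Γ) ↔
      ∀ g, ∀ᶠ i in l, ((u i).FixesBase g ↔ Γ.FixesBase g) := by
  rw [isEmbedding_closedWords.tendsto_nhds_iff, tendsto_pi_nhds]
  refine forall_congr' fun g => ?_
  rw [nhds_discrete Bool, Filter.tendsto_pure]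
  simp only [Function.comp_apply, closedWords_eq_iff]

/-- Words act on marked graphs by moving the base vertex. -/
instance : MulAction (FreeGroup S) (GraphSpace S) where
  smul g := Quotient.map (MarkedGraph.shift g) fun Γ Δ h => MarkedGraph.equiv_iff.mpr fun k => by
    rw [MarkedGraph.fixesBase_shift, MarkedGraph.fixesBase_shift]
    exact MarkedGraph.equiv_iff.mp h _
  one_smul Γ := by
    induction Γ using Quotient.inductionOn with
    | h Γ => exact Quotient.sound (MarkedGraph.equiv_iff.mpr fun k => by
        rw [MarkedGraph.fixesBase_shift]; simp)
  mul_smul g h Γ := by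
    induction Γ using Quotient.inductionOn with
    | h Γ => exact Quotient.sound (MarkedGraph.equiv_iff.mpr fun k => by
        simp only [MarkedGraph.fixesBase_shift]
        simp [mul_assoc])

theorem fixesBase_smul (g h : FreeGroup S) (Γ : GraphSpace S) :
    (g • Γ).FixesBase h ↔ Γ.FixesBase (g⁻¹ * h * g) := by
  induction Γ using Quotient.inductionOn with
  | h Γ => exact MarkedGraph.fixesBase_shift g h Γ

instance [Finite S] : ContinuousConstSMul (FreeGroup S) (GraphSpace S) where
  continuous_const_smul g := continuous_iff_continuousAt.mpr fun Γ => by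
    refine tendsto_nhds_iff.mpr fun h => ?_
    simp only [fixesBase_smul]
    exact tendsto_nhds_iff.mp Filter.tendsto_id _

theorem fixesBase_orbitalSchreierGraph {G M : Type} [Group G] [MulAction G M] (gen : S → G)
    (y : M) (g : FreeGroup S) :
    FixesBase ⟦orbitalSchreierGraph gen y⟧ g ↔ FreeGroup.lift gen g • y = y := by
  have key : FreeGroup.lift (fun s => (MulAction.toPerm (gen s) :
      Equiv.Perm (MulAction.orbit G y))) =
        (MulAction.toPermHom G (MulAction.orbit G y)).comp (FreeGroup.lift gen) :=
    FreeGroup.ext_hom _ _ fun s => by simp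
  change FreeGroup.lift (fun s => (MulAction.toPerm (gen s) :
    Equiv.Perm (MulAction.orbit G y))) g ⟨y, MulAction.mem_orbit_self y⟩ = ⟨y, _⟩ ↔ _
  rw [key]
  exact Subtype.ext_iff

end GraphSpace

/-! ### Finite binary words -/

/-- The infinite word `uw`. -/
def prepend (u : List (Fin 2)) (w : BinSeq) : BinSeq := u.foldr consWord w

@[simp]
theorem prepend_nil (w : BinSeq) : prepend [] w = w := rfl

@[simp]
theorem prepend_cons (a : Fin 2) (u : List (Fin 2)) (w : BinSeq) :
    prepend (a :: u) w = consWord a (prepend u w) := rfl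

theorem prepend_append (u v : List (Fin 2)) (w : BinSeq) :
    prepend (u ++ v) w = prepend u (prepend v w) := by
  simp [prepend]

theorem consWord_inj {a b : Fin 2} {w v : BinSeq} :
    consWord a w = consWord b v ↔ a = b ∧ w = v := by
  constructor
  · intro h
    exact ⟨congrFun h 0, funext fun n => congrFun h (n + 1)⟩
  · rintro ⟨rfl, rfl⟩
    rfl

theorem prepend_injective (u : List (Fin 2)) : Function.Injective (prepend u) := by
  induction u with
  | nil => exact fun _ _ h => h
  | cons a u ih => exact fun _ _ h => ih (consWord_inj.mp h).2

theorem consWord_head_tail (w : BinSeq) : consWord (w 0) (fun i => w (i + 1)) = w := by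
  funext n
  cases n <;> rfl

theorem exists_eq_consWord (w : BinSeq) : ∃ a v, w = consWord a v :=
  ⟨_, _, (consWord_head_tail w).symm⟩

theorem exists_eq_prepend (n : ℕ) (w : BinSeq) : ∃ u v, u.length = n ∧ w = prepend u v := by
  induction n generalizing w with
  | zero => exact ⟨[], w, rfl, rfl⟩
  | succ n ih =>
    obtain ⟨a, v, rfl⟩ := exists_eq_consWord w
    obtain ⟨u, v, rfl, rfl⟩ := ih v
    exact ⟨a :: u, v, rfl, rfl⟩

theorem prepend_apply_add (u : List (Fin 2)) (w : BinSeq) (n : ℕ) :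
    prepend u w (n + u.length) = w n := by
  induction u with
  | nil => rfl
  | cons a u ih => exact ih

theorem prepend_apply_of_lt {u : List (Fin 2)} {n : ℕ} (h : n < u.length) (w v : BinSeq) :
    prepend u w n = prepend u v n := by
  induction u generalizing n with
  | nil => simp at h
  | cons a u ih =>
    cases n with
    | zero => rfl
    | succ n => exact ih (by simpa using h)

theorem exists_eq_prepend_of_forall_lt {u : List (Fin 2)} {w v : BinSeq}
    (h : ∀ n < u.length, v n = prepend u w n) : ∃ w', v = prepend u w' := by
  induction u generalizing v with
  | nil => exact ⟨v, rfl⟩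
  | cons a u ih =>
    obtain ⟨b, v, rfl⟩ := exists_eq_consWord v
    obtain ⟨w', rfl⟩ := ih (v := v) fun n hn => h (n + 1) (by simpa using hn)
    obtain rfl : b = a := h 0 (by simp)
    exact ⟨w', rfl⟩

/-- Two finite words with a common infinite extension are comparable. -/
theorem prepend_eq_prepend {u v : List (Fin 2)} {a b : BinSeq} (h : prepend u a = prepend v b) :
    (∃ z, v = u ++ z ∧ a = prepend z b) ∨ ∃ z, u = v ++ z ∧ b = prepend z a := by
  induction u generalizing v with
  | nil => exact Or.inl ⟨v, rfl, h⟩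
  | cons c u ih =>
    cases v with
    | nil => exact Or.inr ⟨c :: u, rfl, h.symm⟩
    | cons d v =>
      obtain ⟨rfl, h'⟩ := consWord_inj.mp h
      rcases ih h' with ⟨z, rfl, hz⟩ | ⟨z, rfl, hz⟩
      · exact Or.inl ⟨z, rfl, hz⟩
      · exact Or.inr ⟨z, rfl, hz⟩

/-- The only solution of `a = za` is the periodic word `zzz…`. -/
theorem eq_of_prepend_self {z : List (Fin 2)} (hz : z ≠ []) {a b : BinSeq} (ha : a = prepend z a)
    (hb : b = prepend z b) : a = b := by
  have hpos := List.length_pos_of_ne_nil hz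
  funext n
  induction n using Nat.strong_induction_on with
  | _ n ih =>
    rw [ha, hb]
    rcases lt_or_ge n z.length with h | h
    · exact prepend_apply_of_lt h _ _
    · obtain ⟨m, rfl⟩ := Nat.exists_eq_add_of_le' h
      rw [prepend_apply_add, prepend_apply_add]
      exact ih m (by omega)

/-- If `ua = va` then one of `u`, `v` extends the other by some nonempty `z`, and `a` solves `a =
za`. So a nontrivial prefix replacement has at most one fixed point. -/
theorem eq_of_prepend_eq_prepend {u v : List (Fin 2)} (huv : u ≠ v) {a b : BinSeq}
    (ha : prepend u a = prepend v a) (hb : prepend u b = prepend v b) : a = b := by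
  rcases prepend_eq_prepend ha with ⟨z, rfl, hz⟩ | ⟨z, rfl, hz⟩
  · refine eq_of_prepend_self (by rintro rfl; simp at huv) hz (prepend_injective u ?_)
    rwa [← prepend_append]
  · refine eq_of_prepend_self (by rintro rfl; simp at huv) hz (prepend_injective v ?_)
    rw [← prepend_append, hb]

/-! ### Cylinders -/

theorem isOpen_range_prepend (u : List (Fin 2)) : IsOpen (range (prepend u)) := by
  have : range (prepend u) = PiNat.cylinder (prepend u fun _ => 0) u.length := by
    ext v
    constructor
    · rintro ⟨w, rfl⟩
      exact fun n hn => prepend_apply_of_lt hn _ _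
    · intro h
      obtain ⟨w, rfl⟩ := exists_eq_prepend_of_forall_lt h
      exact ⟨w, rfl⟩
  rw [this]
  exact PiNat.isOpen_cylinder _ _ _

theorem range_prepend_mem_nhds (u : List (Fin 2)) (w : BinSeq) :
    range (prepend u) ∈ 𝓝 (prepend u w) :=
  (isOpen_range_prepend u).mem_nhds ⟨w, rfl⟩

theorem exists_range_prepend_subset {w : BinSeq} {U : Set BinSeq} (hU : U ∈ 𝓝 w) :
    ∃ u v, u ≠ [] ∧ w = prepend u v ∧ range (prepend u) ⊆ U := by
  obtain ⟨_, ⟨x, n, rfl⟩, hw, hxU⟩ :=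
    (PiNat.isTopologicalBasis_cylinders fun _ : ℕ => Fin 2).mem_nhds_iff.mp hU
  -- The extra letter guarantees a nonempty prefix, even for the trivial cylinder.
  obtain ⟨u, v, hu, rfl⟩ := exists_eq_prepend (n + 1) w
  refine ⟨u, v, by rintro rfl; simp at hu, rfl, ?_⟩
  rintro _ ⟨v', rfl⟩
  refine hxU fun i hi => (prepend_apply_of_lt (by omega) v' v).trans (hw i hi)

theorem continuous_prepend (u : List (Fin 2)) : Continuous (prepend u) := by
  induction u with
  | nil => exact continuous_id
  | cons a u ih =>
    refine continuous_pi fun n => ?_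
    cases n with
    | zero => exact continuous_const
    | succ n => exact (continuous_apply n).comp ih

/-! ### Values of binary words -/

theorem endsInZeros_prepend_iff (u : List (Fin 2)) (w : BinSeq) :
    EndsInZeros (prepend u w) ↔ EndsInZeros w := by
  induction u with
  | nil => rfl
  | cons a u ih => rw [prepend_cons, endsInZeros_consWord_iff, ih]

theorem exists_binVal_prepend (u : List (Fin 2)) :
    ∃ p : ℕ, p < 2 ^ u.length ∧
      ∀ w, (binVal (prepend u w) : ℝ) = (p + binVal w) / 2 ^ u.length := by
  induction u with
  | nil => exact ⟨0, by simp, by simp⟩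
  | cons a u ih =>
    obtain ⟨p, hp, hw⟩ := ih
    refine ⟨a * 2 ^ u.length + p, ?_, fun w => ?_⟩
    · have : (a : ℕ) * 2 ^ u.length ≤ 1 * 2 ^ u.length := Nat.mul_le_mul_right _ (by omega)
      rw [List.length_cons, pow_succ]
      omega
    · rw [prepend_cons, coe_binVal_consWord, hw, List.length_cons]
      push_cast
      field_simp
      ring

theorem exists_word_of_lt_two_pow {q p : ℕ} (h : p < 2 ^ q) :
    ∃ u : List (Fin 2), ∀ w, (binVal (prepend u w) : ℝ) = (p + binVal w) / 2 ^ q := by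
  induction q generalizing p with
  | zero =>
    obtain rfl : p = 0 := by simpa using h
    exact ⟨[], by simp⟩
  | succ q ih =>
    rcases lt_or_ge p (2 ^ q) with hp | hp
    · obtain ⟨u, hu⟩ := ih hp
      refine ⟨0 :: u, fun w => ?_⟩
      rw [prepend_cons, coe_binVal_consWord, hu]
      simp
      field_simp
      ring
    · obtain ⟨r, rfl⟩ := Nat.exists_eq_add_of_le hp
      obtain ⟨u, hu⟩ := ih (p := r) (by rw [pow_succ] at h; omega)
      refine ⟨1 :: u, fun w => ?_⟩
      rw [prepend_cons, coe_binVal_consWord, hu]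
      push_cast
      field_simp
      simp
      ring

theorem binVal_prepend_congr (u : List (Fin 2)) {w v : BinSeq} (h : binVal w = binVal v) :
    binVal (prepend u w) = binVal (prepend u v) := by
  obtain ⟨p, -, hp⟩ := exists_binVal_prepend u
  exact Subtype.ext (by rw [hp, hp, h])

theorem coe_binVal_zeros : (binVal (fun _ => 0) : ℝ) = 0 := by
  simp [binVal, Real.ofDigits, Real.ofDigitsTerm]

theorem coe_binVal_ones : (binVal (fun _ => 1) : ℝ) = 1 := Real.ofDigits_const_last_eq_one 1

theorem exists_binVal_eq (t : I) : ∃ w, binVal w = t := by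
  obtain ⟨w, -, hw⟩ := Real.ofDigits_SurjOn (b := 2) (by norm_num) t.2
  exact ⟨w, Subtype.ext hw⟩

/-- The action preserves ending in zeros, so fixing the number already fixes each of its expansions.
Stabilizers can therefore be computed on words. -/
theorem cantor_smul_eq_self_iff (f : ThompsonF) (w : BinSeq) :
    f • w = w ↔ f • binVal w = binVal w :=
  ⟨fun h => by rw [← (cantor_smul_spec f w).1, h], fun h => cantor_smul_eq_of h.symm Iff.rfl⟩

theorem eq_one_of_forall_smul_eq {f : ThompsonF} (h : ∀ w : BinSeq, f • w = w) : f = 1 := by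
  refine Subtype.ext (Homeomorph.ext fun t => ?_)
  obtain ⟨w, rfl⟩ := exists_binVal_eq t
  exact (cantor_smul_eq_self_iff f w).mp (h w)

/-! ### Elements of `F` as prefix replacements -/

/-- On the words that start with `u`, the element `f` replaces the prefix `u` by another one. -/
def ReplacesPrefix (f : ThompsonF) (u : List (Fin 2)) : Prop :=
  ∃ v, ∀ w, f • prepend u w = prepend v w

/-- Finite rooted binary trees. -/
inductive BinTree : Type
  | leaf : BinTree
  | node : BinTree → BinTree → BinTree

/-- The element `f` replaces the prefix `uv` for every leaf `v` of the tree. -/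
def ReplacesLeaves (f : ThompsonF) : BinTree → List (Fin 2) → Prop
  | .leaf, u => ReplacesPrefix f u
  | .node A B, u => ReplacesLeaves f A (u ++ [0]) ∧ ReplacesLeaves f B (u ++ [1])

theorem exists_replacesLeaves_of_forall {f : ThompsonF} (n : ℕ) {u : List (Fin 2)}
    (h : ∀ v, v.length = n → ∃ T, ReplacesLeaves f T (u ++ v)) : ∃ T, ReplacesLeaves f T u := by
  induction n generalizing u with
  | zero => simpa using h [] rfl
  | succ n ih =>
    obtain ⟨A, hA⟩ := ih (u := u ++ [0]) fun v hv => by simpa using h (0 :: v) (by simpa using hv)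
    obtain ⟨B, hB⟩ := ih (u := u ++ [1]) fun v hv => by simpa using h (1 :: v) (by simpa using hv)
    exact ⟨.node A B, hA, hB⟩

/-- The cylinder of `u` is a dyadic interval of length `2 ^ (-|u|)`; a slope `2 ^ k` turns it into
one of length `2 ^ (-q)` with `q = |u| - k`. Once `q ≥ m`, its left end is an integer over `2 ^ q`,
so the image is again a cylinder. -/
theorem replacesPrefix_of_affine {f : ThompsonF} {u : List (Fin 2)} {k : ℤ} {l : ℤ} {m q : ℕ}
    (hf : ∀ w, ((f • binVal (prepend u w) : I) : ℝ) = 2 ^ k * binVal (prepend u w) + l / 2 ^ m)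
    (hq : (q : ℤ) = u.length - k) (hmq : m ≤ q) : ReplacesPrefix f u := by
  obtain ⟨p, -, hp⟩ := exists_binVal_prepend u
  have hval : ∀ w, ((f • binVal (prepend u w) : I) : ℝ) =
      ((p + l * 2 ^ (q - m) : ℤ) + binVal w) / 2 ^ q := by
    intro w
    have h1 : (2 : ℝ) ^ k = 2 ^ u.length / 2 ^ q := by
      rw [← zpow_natCast, ← zpow_natCast, ← zpow_sub₀ (by norm_num), hq]
      congr 1
      ring
    have h2 : (2 : ℝ) ^ q = 2 ^ (q - m) * 2 ^ m := by rw [← pow_add, Nat.sub_add_cancel hmq]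
    rw [hf, hp, h1]
    push_cast
    have h3 : (l : ℝ) / 2 ^ m = l * 2 ^ (q - m) / 2 ^ q := by
      rw [h2]
      field_simp
    rw [h3]
    field_simp
    ring
  generalize (p + l * 2 ^ (q - m) : ℤ) = P at hval
  -- Evaluating at `000…` and `111…` shows `0 ≤ P < 2 ^ q`; the new prefix is the expansion of `P`
  -- with `q` digits.
  have hpos : (0 : ℝ) < 2 ^ q := by positivity
  have h0 : 0 ≤ P := by
    have h := hval fun _ => 0
    rw [coe_binVal_zeros, add_zero] at h
    have h' := (f • binVal (prepend u fun _ => 0) : I).2.1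
    rw [h, le_div_iff₀ hpos, zero_mul] at h'
    exact_mod_cast h'
  have h1 : P + 1 ≤ 2 ^ q := by
    have h := hval fun _ => 1
    rw [coe_binVal_ones] at h
    have h' := (f • binVal (prepend u fun _ => 1) : I).2.2
    rw [h, div_le_iff₀ hpos, one_mul] at h'
    exact_mod_cast h'
  obtain ⟨P, rfl⟩ := Int.eq_ofNat_of_zero_le h0
  obtain ⟨v, hv⟩ := exists_word_of_lt_two_pow (q := q) (p := P) (by exact_mod_cast h1)
  refine ⟨v, fun w => cantor_smul_eq_of (Subtype.ext ?_) ?_⟩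
  · rw [hv, hval]
    simp
  · rw [endsInZeros_prepend_iff, endsInZeros_prepend_iff]

theorem exists_forall_not_between (B : Finset I) (hB : ∀ b ∈ B, IsDyadic b) :
    ∃ N : ℕ, ∀ b ∈ B, ∀ p : ℕ, ¬ ((p : ℝ) / 2 ^ N < b ∧ (b : ℝ) < (p + 1) / 2 ^ N) := by
  classical
  induction B using Finset.induction_on with
  | empty => exact ⟨0, by simp⟩
  | insert a B ha ih =>
    obtain ⟨N, hN⟩ := ih fun b hb => hB b (Finset.mem_insert_of_mem hb)
    obtain ⟨k, m, hk⟩ := hB a (Finset.mem_insert_self a B)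
    -- Refining the subdivision keeps this property: an interval of level `N + n` lies in the
    -- interval of level `N` with index `p / 2 ^ n`.
    have key : ∀ (n : ℕ) (b : ℝ) (p : ℕ),
        (∀ r : ℕ, ¬ ((r : ℝ) / 2 ^ N < b ∧ b < (r + 1) / 2 ^ N)) →
        ¬ ((p : ℝ) / 2 ^ (N + n) < b ∧ b < (p + 1) / 2 ^ (N + n)) := by
      rintro n b p h ⟨h1, h2⟩
      have hpos : (0 : ℝ) < 2 ^ n := by positivity
      have hposN : (0 : ℝ) < 2 ^ N := by positivity
      refine h (p / 2 ^ n) ⟨lt_of_le_of_lt ?_ h1, lt_of_lt_of_le h2 ?_⟩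
      · rw [pow_add, mul_comm, ← div_div]
        gcongr
        exact_mod_cast Nat.cast_div_le (α := ℝ) (m := p) (n := 2 ^ n)
      · rw [pow_add, mul_comm, ← div_div]
        gcongr
        rw [div_le_iff₀ hpos]
        have : p + 1 ≤ (p / 2 ^ n + 1) * 2 ^ n := by
          have := Nat.lt_div_mul_add (a := p) (b := 2 ^ n) (by positivity)
          rw [add_mul, one_mul]
          omega
        exact_mod_cast this
    refine ⟨N + m, fun b hb p => ?_⟩
    rcases Finset.mem_insert.mp hb with rfl | hb
    · rintro ⟨h1, h2⟩
      have hpos : (0 : ℝ) < 2 ^ (N + m) := by positivity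
      have h3 : (b : ℝ) = (k * 2 ^ N) / 2 ^ (N + m) := by
        rw [hk, pow_add]
        field_simp
      rw [h3, div_lt_div_iff_of_pos_right hpos] at h1 h2
      have h1' : (p : ℤ) < k * 2 ^ N := by exact_mod_cast h1
      have h2' : k * 2 ^ N < (p : ℤ) + 1 := by exact_mod_cast h2
      omega
    · exact key m b p (hN b hb)

/-- Subdivide until no breakpoint is interior to a dyadic interval; on each piece `f` is affine with
dyadic constant term, and further subdivision makes the image of every piece a cylinder. -/
theorem exists_replacesLeaves (f : ThompsonF) : ∃ T, ReplacesLeaves f T [] := by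
  obtain ⟨B, hB, hlin⟩ := f.2.2
  have hf0 := strictMono_homeomorph_zero f.1 f.2.1
  obtain ⟨N, hN⟩ := exists_forall_not_between B hB
  refine exists_replacesLeaves_of_forall N fun u hu => ?_
  rw [List.nil_append]
  obtain ⟨p, -, hp⟩ := exists_binVal_prepend u
  have hs := hp fun _ => 0
  have ht := hp fun _ => 1
  rw [coe_binVal_zeros, add_zero, hu] at hs
  rw [coe_binVal_ones, hu] at ht
  obtain ⟨k, c, hc⟩ := hlin (binVal (prepend u fun _ => 0)) (binVal (prepend u fun _ => 1))
    (by
      rw [← Subtype.coe_lt_coe, hs, ht]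
      gcongr
      linarith)
    (fun b hb hbt => hN b hb p (by
      rw [← hs, ← ht]
      exact hbt))
  have haff : ∀ w, ((f • binVal (prepend u w) : I) : ℝ) = 2 ^ k * binVal (prepend u w) + c := by
    refine fun w => hc _ ⟨?_, ?_⟩
    · rw [← Subtype.coe_le_coe, hs, hp, hu]
      gcongr
      linarith [(binVal w).2.1]
    · rw [← Subtype.coe_le_coe, ht, hp, hu]
      gcongr
      exact (binVal w).2.2
  have hcd : IsDyadic c := by
    have h0 : EndsInZeros (prepend u fun _ => 0) :=
      (endsInZeros_prepend_iff u _).mpr ⟨0, fun _ _ => rfl⟩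
    have h := haff fun _ => 0
    have : c = ((f • binVal (prepend u fun _ => 0) : I) : ℝ) +
        -(2 ^ k * binVal (prepend u fun _ => 0)) := by rw [h]; ring
    rw [this]
    exact (f.2.2.isDyadic_apply hf0 h0.isDyadic).add
      ((IsDyadic.two_zpow k).mul h0.isDyadic).neg
  obtain ⟨l, m, rfl⟩ := hcd
  -- The extra depth `m + |k|` makes the image depth `N + m + |k| - k` at least `m`.
  refine exists_replacesLeaves_of_forall (m + k.natAbs) fun v hv => ⟨.leaf, ?_⟩
  refine replacesPrefix_of_affine (k := k) (l := l) (m := m) (q := (N + m + k.natAbs - k).toNat)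
    (fun w => ?_) ?_ ?_
  · rw [prepend_append]
    exact haff _
  · rw [List.length_append, hu, hv]
    omega
  · omega

theorem exists_replacesPrefix (f : ThompsonF) (w : BinSeq) :
    ∃ u v, w = prepend u v ∧ ReplacesPrefix f u := by
  have key : ∀ T u w, ReplacesLeaves f T u → ∃ u' v, prepend u w = prepend u' v ∧
      ReplacesPrefix f u' := by
    intro T
    induction T with
    | leaf => exact fun u w h => ⟨u, w, rfl, h⟩
    | node A B ihA ihB =>
      intro u w ⟨hA, hB⟩
      obtain ⟨a, w, rfl⟩ := exists_eq_consWord w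
      rcases fin_two_cases a with ⟨rfl, -⟩ | ⟨rfl, -⟩
      · simpa [prepend_append] using ihA _ w hA
      · simpa [prepend_append] using ihB _ w hB
  obtain ⟨T, hT⟩ := exists_replacesLeaves f
  exact key T [] w hT

instance : ContinuousConstSMul ThompsonF BinSeq where
  continuous_const_smul f := continuous_iff_continuousAt.mpr fun w => by
    obtain ⟨u, w, rfl, v, hv⟩ := exists_replacesPrefix f w
    have hc : Continuous fun w : BinSeq => prepend v fun i => w (i + u.length) :=
      (continuous_prepend v).comp (continuous_pi fun i => continuous_apply _)
    refine hc.continuousAt.congr ?_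
    filter_upwards [range_prepend_mem_nhds u w]
    rintro _ ⟨w', rfl⟩
    simp only [prepend_apply_add]
    exact (hv w').symm

/-- Near every infinite word, an element of `F` is either the identity or has no other fixed
point. -/
theorem eventually_smul_eq_or_ne (f : ThompsonF) (w : BinSeq) :
    (∀ᶠ v in 𝓝 w, f • v = v) ∨ ∀ᶠ v in 𝓝[≠] w, f • v ≠ v := by
  obtain ⟨u, w, rfl, u', hu'⟩ := exists_replacesPrefix f w
  have hmem := range_prepend_mem_nhds u w
  by_cases h : u = u'
  · left
    filter_upwards [hmem]
    rintro _ ⟨v, rfl⟩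
    rw [hu', h]
  · right
    -- With `u ≠ u'` there is at most one fixed point in the cylinder, and it can be removed from a
    -- punctured neighborhood whether or not it is the center.
    by_cases hfix : ∃ a, prepend u a = prepend u' a
    · obtain ⟨a, ha⟩ := hfix
      have : {prepend u a}ᶜ ∈ 𝓝[≠] prepend u w := by
        rcases eq_or_ne (prepend u w) (prepend u a) with h | h
        · rw [h]
          exact self_mem_nhdsWithin
        · exact mem_nhdsWithin_of_mem_nhds (isOpen_ne.mem_nhds h)
      filter_upwards [this, mem_nhdsWithin_of_mem_nhds hmem]
      rintro _ hne ⟨v, rfl⟩ hv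
      rw [hu'] at hv
      exact hne (congrArg _ (eq_of_prepend_eq_prepend h hv.symm ha))
    · filter_upwards [mem_nhdsWithin_of_mem_nhds hmem]
      rintro _ ⟨v, rfl⟩ hv
      exact hfix ⟨v, by rw [← hu', hv]⟩

/-! ### Generation of `F` by `x₀` and `x₁` -/

/-- The finite word `1ᵏ`. -/
abbrev ones (k : ℕ) : List (Fin 2) := List.replicate k 1

theorem prepend_ones_succ (k : ℕ) (w : BinSeq) :
    prepend (ones (k + 1)) w = prepend (ones k) (consWord 1 w) := by
  rw [ones, List.replicate_succ', prepend_append]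
  rfl

/-- The standard infinite family of generators of `F`: the element `xGen k` acts as `x₀` on the
words that start with `1ᵏ`. -/
noncomputable def xGen : ℕ → ThompsonF
  | 0 => x₀
  | 1 => x₁
  | k + 2 => x₀⁻¹ * xGen (k + 1) * x₀

theorem xGen_mem (k : ℕ) : xGen k ∈ Subgroup.closure {x₀, x₁} := by
  have h0 : x₀ ∈ Subgroup.closure {x₀, x₁} := Subgroup.subset_closure (by simp)
  match k with
  | 0 => exact h0
  | 1 => exact Subgroup.subset_closure (Or.inr rfl)
  | k + 2 => exact mul_mem (mul_mem (inv_mem h0) (xGen_mem (k + 1))) h0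

theorem word_cases (w : BinSeq) : (∃ v, w = consWord 0 v) ∨ (∃ v, w = consWord 1 (consWord 0 v)) ∨
    ∃ v, w = consWord 1 (consWord 1 v) := by
  obtain ⟨a, w, rfl⟩ := exists_eq_consWord w
  obtain ⟨b, v, rfl⟩ := exists_eq_consWord w
  rcases fin_two_cases a with ⟨rfl, -⟩ | ⟨rfl, -⟩
  · exact Or.inl ⟨_, rfl⟩
  · rcases fin_two_cases b with ⟨rfl, -⟩ | ⟨rfl, -⟩
    · exact Or.inr (Or.inl ⟨_, rfl⟩)
    · exact Or.inr (Or.inr ⟨_, rfl⟩)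

theorem x₁_smul_consWord_one (w : BinSeq) : x₁ • consWord 1 w = consWord 1 (x₀ • w) := by
  rcases word_cases w with ⟨v, rfl⟩ | ⟨v, rfl⟩ | ⟨v, rfl⟩
  · rw [(x₁_smul_word v).2.1, (x₀_smul_word v).1]
  · rw [(x₁_smul_word v).2.2.1, (x₀_smul_word v).2.1]
  · rw [(x₁_smul_word v).2.2.2, (x₀_smul_word v).2.2]

theorem xGen_smul_prepend (k : ℕ) (w : BinSeq) :
    xGen k • prepend (ones k) w = prepend (ones k) (x₀ • w) := by
  match k with
  | 0 => rfl
  | 1 => exact x₁_smul_consWord_one w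
  | k + 2 =>
    rw [xGen, mul_smul, mul_smul, inv_smul_eq_iff]
    have h := (x₀_smul_word (prepend (ones k) w)).2.2
    have h' := (x₀_smul_word (prepend (ones k) (x₀ • w))).2.2
    have ih := xGen_smul_prepend (k + 1) w
    simp only [ones, List.replicate_succ, prepend_cons] at ih ⊢
    rw [h, h', ih]

theorem xGen_smul_of_notMem {k : ℕ} {w : BinSeq} (hw : w ∉ range (prepend (ones k))) :
    xGen k • w = w := by
  match k with
  | 0 => exact absurd ⟨w, rfl⟩ hw
  | 1 =>
    rcases word_cases w with ⟨v, rfl⟩ | ⟨v, rfl⟩ | ⟨v, rfl⟩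
    · exact (x₁_smul_word v).1
    · exact absurd ⟨_, rfl⟩ hw
    · exact absurd ⟨_, rfl⟩ hw
  | k + 2 =>
    have h0 : ∀ v, consWord 0 v ∉ range (prepend (ones (k + 1))) := by
      rintro v ⟨z, hz⟩
      exact absurd (congrFun hz 0) (by simp [ones, List.replicate_succ, consWord])
    rw [xGen, mul_smul, mul_smul, inv_smul_eq_iff]
    apply xGen_smul_of_notMem
    rcases word_cases w with ⟨v, rfl⟩ | ⟨v, rfl⟩ | ⟨v, rfl⟩
    · rw [(x₀_smul_word v).1]
      exact h0 _
    · rw [(x₀_smul_word v).2.1]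
      exact h0 _
    · rw [(x₀_smul_word v).2.2]
      rintro ⟨z, hz⟩
      refine hw ⟨z, ?_⟩
      rw [ones, List.replicate_succ, prepend_cons, hz]

/-- `f` fixes all words that do not start with `1ᵏ`. -/
def SupportedAt (f : ThompsonF) (k : ℕ) : Prop := ∀ w ∉ range (prepend (ones k)), f • w = w

theorem SupportedAt.mem_range_iff {f : ThompsonF} {k : ℕ} (h : SupportedAt f k) (w : BinSeq) :
    f • w ∈ range (prepend (ones k)) ↔ w ∈ range (prepend (ones k)) := by
  constructor
  · intro hw
    by_contra hn
    rw [h w hn] at hw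
    exact hn hw
  · intro hw
    by_contra hn
    rw [smul_left_cancel f (h _ hn)] at hn
    exact hn hw

theorem xGen_supportedAt (k : ℕ) : SupportedAt (xGen k) k := fun _ => xGen_smul_of_notMem

theorem SupportedAt.mul {f g : ThompsonF} {k : ℕ} (hf : SupportedAt f k) (hg : SupportedAt g k) :
    SupportedAt (f * g) k := fun w hw => by rw [mul_smul, hg w hw, hf w hw]

theorem SupportedAt.inv {f : ThompsonF} {k : ℕ} (hf : SupportedAt f k) : SupportedAt f⁻¹ k :=
  fun w hw => by rw [inv_smul_eq_iff, hf w hw]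

/-- For `k = 0` this is `f 0 = 0`. Otherwise `1ᵏ000…` represents the same number as `1ᵏ⁻¹0111…`,
which lies outside the support. -/
theorem SupportedAt.smul_prepend_zeros {f : ThompsonF} {k : ℕ} (h : SupportedAt f k) :
    f • prepend (ones k) (fun _ => 0) = prepend (ones k) fun _ => 0 := by
  rw [cantor_smul_eq_self_iff]
  cases k with
  | zero =>
    have : binVal (fun _ => 0) = 0 := Subtype.ext coe_binVal_zeros
    rw [ones, List.replicate_zero, prepend_nil, this]
    exact strictMono_homeomorph_zero f.1 f.2.1
  | succ k =>
    have heq : binVal (prepend (ones (k + 1)) fun _ => 0) =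
        binVal (prepend (ones k) (consWord 0 fun _ => 1)) := by
      rw [prepend_ones_succ]
      refine binVal_prepend_congr _ (Subtype.ext ?_)
      rw [coe_binVal_consWord, coe_binVal_consWord, coe_binVal_zeros, coe_binVal_ones]
      simp
    rw [heq, ← cantor_smul_eq_self_iff]
    refine h _ ?_
    rintro ⟨w, hw⟩
    rw [prepend_ones_succ] at hw
    exact absurd (consWord_inj.mp (prepend_injective _ hw)).1 (by simp)

theorem exists_replicate_of_prepend_zeros {z : List (Fin 2)} {w : BinSeq}
    (h : (fun _ => 0) = prepend z w) : z = List.replicate z.length 0 := by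
  rw [List.eq_replicate_iff]
  refine ⟨rfl, fun b hb => ?_⟩
  induction z with
  | nil => simp at hb
  | cons a z ih =>
    have h' : (consWord 0 fun _ => 0) = consWord a (prepend z w) :=
      (consWord_head_tail fun _ => 0).trans h
    obtain ⟨rfl, hz⟩ := consWord_inj.mp h'
    rcases List.mem_cons.mp hb with rfl | hb
    · rfl
    · exact ih hz hb

theorem exists_eq_ones_append {k : ℕ} {v : List (Fin 2)}
    (h : prepend v (fun _ => 0) = prepend (ones k) fun _ => 0) :
    ∃ j, v = ones k ++ List.replicate j 0 := by
  rcases prepend_eq_prepend h with ⟨z, hz, h'⟩ | ⟨z, rfl, h'⟩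
  · have hz0 := exists_replicate_of_prepend_zeros h'
    have : z = [] := by
      by_contra hne
      obtain ⟨a, ha⟩ := List.exists_mem_of_ne_nil z hne
      have h1 : a = 1 := List.eq_of_mem_replicate (n := k) (by
        rw [← ones, hz]
        exact List.mem_append_right _ ha)
      rw [hz0] at ha
      have h0 := List.eq_of_mem_replicate ha
      rw [h0] at h1
      exact absurd h1 (by simp)
    exact ⟨0, by simp [hz, this]⟩
  · exact ⟨z.length, by rw [← exists_replicate_of_prepend_zeros h']⟩

theorem ReplacesLeaves.of_imp {f g : ThompsonF} {T : BinTree} {u : List (Fin 2)}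
    (h : ReplacesLeaves f T u)
    (H : ∀ z, ReplacesPrefix f (u ++ z) → ReplacesPrefix g (u ++ z)) :
    ReplacesLeaves g T u := by
  induction T generalizing u with
  | leaf => simpa [ReplacesLeaves] using H [] (by simpa [ReplacesLeaves] using h)
  | node A B ihA ihB =>
    refine ⟨ihA h.1 fun z hz => ?_, ihB h.2 fun z hz => ?_⟩
    · simpa using H (0 :: z) (by simpa using hz)
    · simpa using H (1 :: z) (by simpa using hz)

theorem ReplacesLeaves.mul {f g : ThompsonF} {T : BinTree} {u v : List (Fin 2)}
    (h : ReplacesLeaves f T v) (hg : ∀ w, g • prepend u w = prepend v w) :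
    ReplacesLeaves (f * g) T u := by
  induction T generalizing u v with
  | leaf =>
    obtain ⟨v', hv'⟩ := h
    exact ⟨v', fun w => by rw [mul_smul, hg, hv']⟩
  | node A B ihA ihB =>
    refine ⟨ihA h.1 fun w => ?_, ihB h.2 fun w => ?_⟩
    · rw [prepend_append, prepend_append, hg]
    · rw [prepend_append, prepend_append, hg]

/-- Since `1ᵏ000…` is fixed, the new prefix is `1ᵏ0ʲ`. The cylinder of `1ᵏ` is mapped onto itself,
so `j = 0`. -/
theorem SupportedAt.eq_one {f : ThompsonF} {k : ℕ} (hf : SupportedAt f k)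
    (h : ReplacesPrefix f (ones k)) : f = 1 := by
  obtain ⟨v, hv⟩ := h
  obtain ⟨j, rfl⟩ := exists_eq_ones_append ((hv fun _ => 0).symm.trans hf.smul_prepend_zeros)
  refine eq_one_of_forall_smul_eq fun w => ?_
  by_cases hw : w ∈ range (prepend (ones k))
  · obtain ⟨w, rfl⟩ := hw
    cases j with
    | zero => simpa using hv w
    | succ j =>
      obtain ⟨y, hy⟩ := (hf.mem_range_iff (f⁻¹ • prepend (ones k) fun _ => 1)).mp
        (by rw [smul_inv_smul]; exact ⟨_, rfl⟩)
      rw [eq_inv_smul_iff, hv, prepend_append] at hy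
      exact absurd (congrFun (prepend_injective _ hy) 0) (by simp [List.replicate_succ, consWord])
  · exact hf w hw

/-- The inverse of `xGen k` replaces the prefixes `1ᵏ00`, `1ᵏ01` and `1ᵏ1`. The new prefix `v`
extends one of them: otherwise its cylinder would contain the fixed point `1ᵏ000…`, which is not in
the cylinder of `1ᵏ1z`. -/
theorem replacesPrefix_inv_xGen_mul {f : ThompsonF} {k : ℕ} (hf : SupportedAt f k)
    {z : List (Fin 2)} (h : ReplacesPrefix f (ones k ++ 1 :: z)) :
    ReplacesPrefix ((xGen k)⁻¹ * f) (ones k ++ 1 :: z) := by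
  obtain ⟨v, hv⟩ := h
  have hne : ∀ d, prepend v d ≠ prepend (ones k) fun _ => 0 := by
    intro d hd
    rw [← hv, ← hf.smul_prepend_zeros] at hd
    have := smul_left_cancel f hd
    rw [prepend_append] at this
    exact absurd (congrFun (prepend_injective _ this) 0) (by simp [consWord])
  suffices H : ∃ v', ∀ w, xGen k • prepend v' w = prepend v w by
    obtain ⟨v', hv'⟩ := H
    exact ⟨v', fun w => by rw [mul_smul, hv, inv_smul_eq_iff, hv']⟩
  obtain ⟨d, hd⟩ := (hf.mem_range_iff (prepend (ones k ++ 1 :: z) fun _ => 0)).mpr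
    ⟨_, (prepend_append _ _ _).symm⟩
  rw [hv] at hd
  have hz0 : (fun _ => 0 : BinSeq) = consWord 0 fun _ => 0 := (consWord_head_tail _).symm
  rcases prepend_eq_prepend hd with ⟨y, rfl, -⟩ | ⟨y, hy, -⟩
  · match y with
    | [] => exact absurd (by simp) (hne fun _ => 0)
    | [0] => exact absurd (by rw [prepend_append]; exact congrArg _ hz0.symm) (hne fun _ => 0)
    | 0 :: 0 :: y =>
      exact ⟨ones k ++ 0 :: y, fun w => by
        simp only [prepend_append, xGen_smul_prepend, prepend_cons, (x₀_smul_word _).1]⟩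
    | 0 :: 1 :: y =>
      exact ⟨ones k ++ 1 :: 0 :: y, fun w => by
        simp only [prepend_append, xGen_smul_prepend, prepend_cons, (x₀_smul_word _).2.1]⟩
    | 1 :: y =>
      exact ⟨ones k ++ 1 :: 1 :: y, fun w => by
        simp only [prepend_append, xGen_smul_prepend, prepend_cons, (x₀_smul_word _).2.2]⟩
  · exact absurd (by rw [hy, prepend_append]) (hne (prepend y fun _ => 0))

/-- Each left factor `(xGen k)⁻¹` removes one of the `j` extra zeros without spoiling the leaves of
`B`. When none is left, `f` is supported on the cylinder of `1ᵏ⁺¹` and `ih` applies. -/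
theorem mem_closure_of_smul_prepend_zero {k : ℕ} {B : BinTree}
    (ih : ∀ f, SupportedAt f (k + 1) → ReplacesLeaves f B (ones (k + 1)) →
      f ∈ Subgroup.closure {x₀, x₁}) (j : ℕ) {f : ThompsonF} (hf : SupportedAt f k)
    (h0 : ∀ w, f • prepend (ones k) (consWord 0 w) =
      prepend (ones k) (consWord 0 (prepend (List.replicate j 0) w)))
    (h1 : ReplacesLeaves f B (ones k ++ [1])) : f ∈ Subgroup.closure {x₀, x₁} := by
  induction j generalizing f with
  | zero =>
    refine ih f (fun w hw => ?_) (by rwa [ones, List.replicate_succ'])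
    by_cases hwk : w ∈ range (prepend (ones k))
    · obtain ⟨w, rfl⟩ := hwk
      obtain ⟨a, w, rfl⟩ := exists_eq_consWord w
      rcases fin_two_cases a with ⟨rfl, -⟩ | ⟨rfl, -⟩
      · exact h0 w
      · exact absurd ⟨w, prepend_ones_succ k w⟩ hw
    · exact hf w hwk
  | succ j ihj =>
    have hmem : (xGen k)⁻¹ * f ∈ Subgroup.closure {x₀, x₁} := by
      refine ihj ((xGen_supportedAt k).inv.mul hf) (fun w => ?_) (h1.of_imp fun z hz => ?_)
      · rw [mul_smul, h0, inv_smul_eq_iff, xGen_smul_prepend, (x₀_smul_word _).1,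
          List.replicate_succ, prepend_cons]
      · rw [List.append_assoc, List.singleton_append] at hz ⊢
        exact replacesPrefix_inv_xGen_mul hf hz
    simpa using mul_mem (xGen_mem k) hmem

theorem SupportedAt.exists_smul_prepend_zero {f : ThompsonF} {k : ℕ} (hf : SupportedAt f k)
    (h : ReplacesPrefix f (ones k ++ [0])) :
    ∃ j, ∀ w, f • prepend (ones k) (consWord 0 w) =
      prepend (ones k) (consWord 0 (prepend (List.replicate j 0) w)) := by
  obtain ⟨v, hv⟩ := h
  have hz0 : (fun _ => 0 : BinSeq) = consWord 0 fun _ => 0 := (consWord_head_tail _).symm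
  have hv0 : prepend v (fun _ => 0) = prepend (ones k) fun _ => 0 := by
    rw [← hv, prepend_append, prepend_cons, prepend_nil, ← hz0, hf.smul_prepend_zeros]
  obtain ⟨j, rfl⟩ := exists_eq_ones_append hv0
  simp only [prepend_append, prepend_cons, prepend_nil] at hv
  cases j with
  | zero =>
    -- If `j = 0`, the cylinder of `1ᵏ0` alone would cover that of `1ᵏ`, against injectivity at
    -- `1ᵏ1000…`.
    obtain ⟨y, hy⟩ := (hf.mem_range_iff (prepend (ones k) (consWord 1 fun _ => 0))).mpr ⟨_, rfl⟩
    have hvy := hv y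
    rw [List.replicate_zero, prepend_nil, hy] at hvy
    have := prepend_injective _ (smul_left_cancel f hvy)
    exact absurd (consWord_inj.mp this).1 (by simp)
  | succ j => exact ⟨j, hv⟩

namespace BinTree

/-- The number of leaves. -/
def size : BinTree → ℕ
  | leaf => 1
  | node A B => A.size + B.size

/-- The number of leaves of the left subtree of the root. -/
def leftSize : BinTree → ℕ
  | leaf => 0
  | node A _ => A.size

theorem size_pos (T : BinTree) : 0 < T.size := by
  induction T with
  | leaf => exact Nat.one_pos
  | node A B ihA _ => exact Nat.add_pos_left ihA _

end BinTree

/-- The tree is turned into a right comb. If the left subtree is a leaf, it can be split off and `k`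
increased; otherwise composing with `xGen k` rotates the tree at its root, keeping the number of
leaves and shrinking the left subtree. Hence the lexicographic measure. -/
theorem mem_closure_of_replacesLeaves (T : BinTree) (k : ℕ) (f : ThompsonF) (hf : SupportedAt f k)
    (h : ReplacesLeaves f T (ones k)) : f ∈ Subgroup.closure {x₀, x₁} := by
  match T with
  | .leaf => exact hf.eq_one h ▸ one_mem _
  | .node .leaf B =>
    obtain ⟨j, hj⟩ := hf.exists_smul_prepend_zero h.1
    exact mem_closure_of_smul_prepend_zero
      (fun g hg hgB => mem_closure_of_replacesLeaves B (k + 1) g hg hgB) j hf hj h.2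
  | .node (.node A₁ A₂) B =>
    -- On words starting with `1ᵏ`, `xGen k` sends the prefixes `0`, `10`, `11` to `00`, `01`, `1`,
    -- which realizes the rotation.
    have key : f * xGen k ∈ Subgroup.closure {x₀, x₁} := by
      refine mem_closure_of_replacesLeaves (.node A₁ (.node A₂ B)) k _
        (hf.mul (xGen_supportedAt k)) ⟨h.1.1.mul fun w => ?_, h.1.2.mul fun w => ?_,
          h.2.mul fun w => ?_⟩
      · simp only [prepend_append, xGen_smul_prepend, prepend_cons, prepend_nil,
          (x₀_smul_word _).1]
      · simp only [prepend_append, xGen_smul_prepend, prepend_cons, prepend_nil,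
          (x₀_smul_word _).2.1]
      · simp only [prepend_append, xGen_smul_prepend, prepend_cons, prepend_nil,
          (x₀_smul_word _).2.2]
    simpa using mul_mem key (inv_mem (xGen_mem k))
termination_by (T.size, T.leftSize)
decreasing_by
  · left
    simp [BinTree.size]
  · have := A₂.size_pos
    simp only [BinTree.size, BinTree.leftSize, ← add_assoc]
    right
    omega

theorem closure_x₀_x₁ : Subgroup.closure {x₀, x₁} = (⊤ : Subgroup ThompsonF) := by
  refine eq_top_iff.mpr fun f _ => ?_
  obtain ⟨T, hT⟩ := exists_replacesLeaves f
  exact mem_closure_of_replacesLeaves T 0 f (fun w hw => absurd ⟨w, rfl⟩ hw) hT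

theorem lift_x₀_x₁_surjective :
    Function.Surjective (FreeGroup.lift ![x₀, x₁] : FreeGroup (Fin 2) →* ThompsonF) := by
  rw [← MonoidHom.range_eq_top, FreeGroup.range_lift_eq_closure, ← closure_x₀_x₁,
    Matrix.range_cons, Matrix.range_cons, Matrix.range_empty, union_empty, singleton_union]

/-! ### The dynamics of `F` on the Cantor set -/

/-- The letter after `10` can be erased: `100 ↦ 10` by `x₁⁻¹`, and `101 ↦ 110 ↦ 10` by `x₁⁻¹`
followed by `x₀`. -/
theorem exists_smul_prepend_one_zero (t : List (Fin 2)) :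
    ∃ f : ThompsonF, ∀ w, f • prepend (1 :: 0 :: t) w = consWord 1 (consWord 0 w) := by
  induction t with
  | nil => exact ⟨1, fun w => one_smul _ _⟩
  | cons a t ih =>
    obtain ⟨f, hf⟩ := ih
    simp only [prepend_cons] at hf ⊢
    rcases fin_two_cases a with ⟨rfl, -⟩ | ⟨rfl, -⟩
    · refine ⟨f * x₁⁻¹, fun w => ?_⟩
      rw [mul_smul, ← hf w, smul_left_cancel_iff, inv_smul_eq_iff, (x₁_smul_word _).2.1]
    · refine ⟨f * x₀ * x₁⁻¹, fun w => ?_⟩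
      have h : x₁⁻¹ • consWord 1 (consWord 0 (consWord 1 (prepend t w))) =
          consWord 1 (consWord 1 (consWord 0 (prepend t w))) := by
        rw [inv_smul_eq_iff, (x₁_smul_word _).2.2.1]
      rw [mul_smul, mul_smul, h, (x₀_smul_word _).2.2, hf]

/-- A cylinder whose word contains both letters can be mapped to the cylinder of `10`. -/
theorem exists_smul_prepend_eq (u : List (Fin 2)) (h0 : 0 ∈ u) (h1 : 1 ∈ u) :
    ∃ f : ThompsonF, ∀ w, f • prepend u w = consWord 1 (consWord 0 w) := by
  -- The initial block is shortened by `x₀` (`11 ↦ 1`) or `x₀⁻¹` (`00 ↦ 0`), and `01` becomes `10`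
  -- under `x₀⁻¹`, until the word starts with `10`.
  match u with
  | [] => simp at h0
  | [0] => simp at h1
  | [1] => simp at h0
  | 1 :: 0 :: t => exact exists_smul_prepend_one_zero t
  | 0 :: 1 :: t =>
    obtain ⟨f, hf⟩ := exists_smul_prepend_one_zero t
    refine ⟨f * x₀⁻¹, fun w => ?_⟩
    rw [mul_smul, ← hf, smul_left_cancel_iff, inv_smul_eq_iff]
    exact (x₀_smul_word _).2.1.symm
  | 1 :: 1 :: t =>
    obtain ⟨f, hf⟩ := exists_smul_prepend_eq (1 :: t) (by simpa using h0) (by simp)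
    refine ⟨f * x₀, fun w => ?_⟩
    rw [mul_smul, ← hf, smul_left_cancel_iff]
    exact (x₀_smul_word _).2.2
  | 0 :: 0 :: t =>
    obtain ⟨f, hf⟩ := exists_smul_prepend_eq (0 :: t) (by simp) (by simpa using h1)
    refine ⟨f * x₀⁻¹, fun w => ?_⟩
    rw [mul_smul, ← hf, smul_left_cancel_iff, inv_smul_eq_iff]
    exact (x₀_smul_word _).1.symm

/-- If `u` contains both letters, it can be moved to `10`, and `x₀x₁⁻¹` then sends `100` to `01` and
`101` to `10`. A constant `u` is shortened by powers of `x₀`. -/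
theorem exists_smul_apply_zero_ne_aux (u : List (Fin 2)) (a b : BinSeq) :
    ∃ f : ThompsonF, (f • prepend u (consWord 0 a)) 0 = 0 ∧
      (f • prepend u (consWord 1 b)) 0 = 1 := by
  by_cases h : 0 ∈ u ∧ 1 ∈ u
  · obtain ⟨f, hf⟩ := exists_smul_prepend_eq u h.1 h.2
    refine ⟨x₀ * x₁⁻¹ * f, ?_, ?_⟩
    · have : x₁⁻¹ • consWord 1 (consWord 0 (consWord 0 a)) = consWord 1 (consWord 0 a) := by
        rw [inv_smul_eq_iff, (x₁_smul_word _).2.1]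
      rw [mul_smul, mul_smul, hf, this, (x₀_smul_word _).2.1]
      rfl
    · have : x₁⁻¹ • consWord 1 (consWord 0 (consWord 1 b)) =
          consWord 1 (consWord 1 (consWord 0 b)) := by
        rw [inv_smul_eq_iff, (x₁_smul_word _).2.2.1]
      rw [mul_smul, mul_smul, hf, this, (x₀_smul_word _).2.2]
      rfl
  match u with
  | [] => exact ⟨1, by rw [one_smul]; rfl, by rw [one_smul]; rfl⟩
  | [0] =>
    have h1 : x₀⁻¹ • consWord 0 (consWord 0 a) = consWord 0 a := by
      rw [inv_smul_eq_iff, (x₀_smul_word _).1]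
    have h2 : x₀⁻¹ • consWord 0 (consWord 1 b) = consWord 1 (consWord 0 b) := by
      rw [inv_smul_eq_iff, (x₀_smul_word _).2.1]
    exact ⟨x₀⁻¹, congrFun h1 0, congrFun h2 0⟩
  | [1] => exact ⟨x₀, congrFun (x₀_smul_word a).2.1 0, congrFun (x₀_smul_word b).2.2 0⟩
  | 1 :: 0 :: t => exact absurd (by simp) h
  | 0 :: 1 :: t => exact absurd (by simp) h
  | 1 :: 1 :: t =>
    obtain ⟨f, hf⟩ := exists_smul_apply_zero_ne_aux (1 :: t) a b
    refine ⟨f * x₀, ?_⟩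
    simp only [prepend_cons] at hf ⊢
    rwa [mul_smul, mul_smul, (x₀_smul_word _).2.2, (x₀_smul_word _).2.2]
  | 0 :: 0 :: t =>
    obtain ⟨f, hf⟩ := exists_smul_apply_zero_ne_aux (0 :: t) a b
    refine ⟨f * x₀⁻¹, ?_⟩
    have h' : ∀ w, x₀⁻¹ • consWord 0 (consWord 0 w) = consWord 0 w := fun w => by
      rw [inv_smul_eq_iff, (x₀_smul_word _).1]
    simp only [prepend_cons] at hf ⊢
    rwa [mul_smul, mul_smul, h', h']

theorem exists_smul_apply_zero_ne {w v : BinSeq} (h : w ≠ v) :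
    ∃ f : ThompsonF, (f • w) 0 ≠ (f • v) 0 := by
  obtain ⟨u, w', hu, rfl⟩ := exists_eq_prepend (PiNat.firstDiff w v) w
  have hne := PiNat.apply_firstDiff_ne h
  obtain ⟨v', rfl⟩ := exists_eq_prepend_of_forall_lt (u := u) (w := w') (v := v) fun n hn =>
    (PiNat.apply_eq_of_lt_firstDiff (hu ▸ hn)).symm
  have hne' : w' 0 ≠ v' 0 := by
    rw [← hu] at hne
    have := prepend_apply_add u w' 0
    have := prepend_apply_add u v' 0
    simp_all
  obtain ⟨a, w', rfl⟩ := exists_eq_consWord w'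
  obtain ⟨b, v', rfl⟩ := exists_eq_consWord v'
  have hab : a ≠ b := hne'
  rcases fin_two_cases a with ⟨rfl, -⟩ | ⟨rfl, -⟩ <;>
    rcases fin_two_cases b with ⟨rfl, -⟩ | ⟨rfl, -⟩
  · exact absurd rfl hab
  · obtain ⟨f, h0, h1⟩ := exists_smul_apply_zero_ne_aux u w' v'
    exact ⟨f, by rw [h0, h1]; exact zero_ne_one⟩
  · obtain ⟨f, h0, h1⟩ := exists_smul_apply_zero_ne_aux u v' w'
    exact ⟨f, by rw [h0, h1]; exact one_ne_zero⟩
  · exact absurd rfl hab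

/-- The words of the points of the orbit of `x`. -/
def orbitWords (x : I) : Set BinSeq := {w | binVal w ∈ MulAction.orbit ThompsonF x}

theorem smul_mem_orbitWords {x : I} (f : ThompsonF) {w : BinSeq} (hw : w ∈ orbitWords x) :
    f • w ∈ orbitWords x := by
  change binVal (f • w) ∈ MulAction.orbit ThompsonF x
  rw [(cantor_smul_spec f w).1]
  exact MulAction.mem_orbit_of_mem_orbit f hw

theorem exists_prefix_mem {w : BinSeq} {n : ℕ} {a : Fin 2} (h : w n = a) :
    ∃ u v, w = prepend u v ∧ a ∈ u := by
  obtain ⟨u, v, hu, rfl⟩ := exists_eq_prepend n w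
  obtain ⟨b, v, rfl⟩ := exists_eq_consWord v
  have := prepend_apply_add u (consWord b v) 0
  rw [zero_add, hu, h] at this
  exact ⟨u ++ [b], v, by rw [prepend_append]; rfl, by simp [this, consWord]⟩

theorem exists_prefix_mem_mem {w : BinSeq} {m n : ℕ} (hm : w m = 0) (hn : w n = 1) :
    ∃ u v, w = prepend u v ∧ 0 ∈ u ∧ 1 ∈ u := by
  obtain ⟨u, v, rfl, hu⟩ := exists_prefix_mem hm
  obtain ⟨u', v', h, hu'⟩ := exists_prefix_mem hn
  rcases prepend_eq_prepend h with ⟨z, rfl, -⟩ | ⟨z, rfl, -⟩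
  · exact ⟨u ++ z, v', h, List.mem_append_left _ hu, hu'⟩
  · exact ⟨u' ++ z, v, rfl, hu, List.mem_append_left _ hu'⟩

/-- Since `0 < x < 1`, an expansion of `x` has a prefix with both letters, and all cylinders of such
prefixes are exchanged by `F`. Thus the orbit meets every cylinder. -/
theorem frequently_mem_orbitWords {x : I} (h0 : 0 < x) (h1 : x < 1) (w : BinSeq) :
    ∃ᶠ v in 𝓝[≠] w, v ∈ orbitWords x := by
  obtain ⟨z, rfl⟩ := exists_binVal_eq x
  have hz0 : ∃ m, z m = 0 := by
    by_contra hne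
    push Not at hne
    have : z = fun _ => 1 := funext fun m => (Fin.eq_one_of_ne_zero (z m) (hne m))
    rw [this, ← Subtype.coe_lt_coe, coe_binVal_ones] at h1
    exact lt_irrefl _ h1
  have hz1 : ∃ n, z n = 1 := by
    by_contra hne
    push Not at hne
    have : z = fun _ => 0 := funext fun m => by
      by_contra h
      exact hne m (Fin.eq_one_of_ne_zero (z m) h)
    rw [this, ← Subtype.coe_lt_coe, coe_binVal_zeros] at h0
    exact lt_irrefl _ h0
  obtain ⟨m, hm⟩ := hz0
  obtain ⟨n, hn⟩ := hz1
  obtain ⟨p, v, rfl, hp0, hp1⟩ := exists_prefix_mem_mem hm hn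
  obtain ⟨f, hf⟩ := exists_smul_prepend_eq p hp0 hp1
  rw [frequently_nhdsWithin_iff, Filter.frequently_iff]
  intro U hU
  obtain ⟨u, w', -, rfl, huU⟩ := exists_range_prepend_subset hU
  -- The letter `a` makes the new word differ from the center; the letters `0`, `1` after it make
  -- the prefix eligible.
  obtain ⟨a, ha⟩ : ∃ a : Fin 2, a ≠ w' 0 := exists_ne _
  obtain ⟨g, hg⟩ := exists_smul_prepend_eq (u ++ [a, 0, 1]) (by simp) (by simp)
  refine ⟨prepend (u ++ [a, 0, 1]) v, huU ⟨_, (prepend_append _ _ _).symm⟩, ?_, ?_⟩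
  · have : prepend (u ++ [a, 0, 1]) v = (g⁻¹ * f) • prepend p v := by
      rw [mul_smul, hf, ← hg, inv_smul_smul]
    rw [this]
    exact smul_mem_orbitWords _ (MulAction.mem_orbit_self _)
  · intro h
    rw [mem_singleton_iff, prepend_append] at h
    exact ha (congrFun (prepend_injective u h) 0)

/-! ### Stabilizers of germs -/

/-- The elements of `F` that are the identity near the infinite word `w`. -/
def germStabilizer (w : BinSeq) : Subgroup ThompsonF where
  carrier := {f | ∀ᶠ v in 𝓝 w, f • v = v}
  one_mem' := Filter.Eventually.of_forall fun v => one_smul _ v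
  mul_mem' {f g} hf hg := by
    filter_upwards [hf, hg] with v hfv hgv
    rw [mul_smul, hgv, hfv]
  inv_mem' {f} hf := by
    filter_upwards [hf] with v hfv
    rw [inv_smul_eq_iff, hfv]

theorem mem_germStabilizer {f : ThompsonF} {w : BinSeq} :
    f ∈ germStabilizer w ↔ ∀ᶠ v in 𝓝 w, f • v = v := Iff.rfl

theorem smul_eq_of_mem_germStabilizer {f : ThompsonF} {w : BinSeq} (h : f ∈ germStabilizer w) :
    f • w = w := (mem_germStabilizer.mp h).self_of_nhds

theorem conj_mem_germStabilizer_iff {f g : ThompsonF} {w : BinSeq} :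
    f⁻¹ * g * f ∈ germStabilizer w ↔ g ∈ germStabilizer (f • w) := by
  have h := (Homeomorph.smul f : BinSeq ≃ₜ BinSeq).map_nhds_eq w
  rw [Homeomorph.smul_apply] at h
  rw [mem_germStabilizer, mem_germStabilizer, ← h, Filter.eventually_map]
  refine Filter.eventually_congr (Filter.Eventually.of_forall fun v => ?_)
  rw [mul_smul, mul_smul, inv_smul_eq_iff, Homeomorph.smul_apply]

/-- After a first letter `1`, `x₁` acts on the tail as `x₀`, whose only fixed points in `[0, 1]` are
`0` and `1`. So only constant tails are fixed, while every cylinder contains a word with nonconstant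
tail. -/
theorem x₁_mem_germStabilizer_iff {w : BinSeq} : x₁ ∈ germStabilizer w ↔ w 0 = 0 := by
  obtain ⟨a, w, rfl⟩ := exists_eq_consWord w
  constructor
  · intro h
    rcases fin_two_cases a with ⟨rfl, -⟩ | ⟨rfl, -⟩
    · rfl
    · exfalso
      obtain ⟨u, v, hu, huv, hsub⟩ := exists_range_prepend_subset (mem_germStabilizer.mp h)
      cases u with
      | nil => exact hu rfl
      | cons b u =>
        obtain ⟨rfl, -⟩ := consWord_inj.mp huv
        have hfix := hsub ⟨consWord 0 (consWord 1 fun _ => 0), rfl⟩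
        have key : ∀ y, x₁ • consWord 1 y = consWord 1 y → ∀ n m, y n = y m := by
          intro y hy n m
          rw [x₁_smul_consWord_one, consWord_inj, cantor_smul_eq_self_iff, Subtype.ext_iff,
            coe_x₀_smul] at hy
          have hy := hy.2
          have : (binVal y : ℝ) = 0 ∨ (binVal y : ℝ) = 1 := by
            unfold x₀Fun at hy
            split_ifs at hy
            · exact Or.inl (by linarith)
            · exact absurd hy (by linarith)
            · exact Or.inr (by linarith)
          rcases this with h | h
          · rw [binVal_eq_zero h, binVal_eq_zero h]
          · rw [binVal_eq_one h, binVal_eq_one h]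
        have h1 : prepend u _ _ = prepend u _ _ := key _ hfix (0 + u.length) (1 + u.length)
        rw [prepend_apply_add, prepend_apply_add] at h1
        exact absurd h1 (by simp [consWord])
  · rintro (rfl : a = 0)
    filter_upwards [range_prepend_mem_nhds [0] w]
    rintro _ ⟨v, rfl⟩
    exact (x₁_smul_word v).1

/-- Germ stabilizers move by conjugation, so membership of conjugates of `x₁` reveals the first
letter of every `f • w`, and these letters separate words. -/
theorem germStabilizer_injective : Function.Injective germStabilizer := by
  intro w v h
  by_contra hne
  obtain ⟨f, hf⟩ := exists_smul_apply_zero_ne hne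
  have : (f • w) 0 = 0 ↔ (f • v) 0 = 0 := by
    rw [← x₁_mem_germStabilizer_iff, ← x₁_mem_germStabilizer_iff, ← conj_mem_germStabilizer_iff,
      ← conj_mem_germStabilizer_iff, h]
  generalize (f • w) 0 = a at *
  generalize (f • v) 0 = b at *
  omega

/-! ### The closure of the family of Schreier graphs -/

theorem fixesBase_schreierGraph_binVal (w : BinSeq) (g : FreeGroup (Fin 2)) :
    (schreierGraph (binVal w)).FixesBase g ↔ FreeGroup.lift ![x₀, x₁] g • w = w := by
  rw [cantor_smul_eq_self_iff]
  exact GraphSpace.fixesBase_orbitalSchreierGraph _ _ _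

/-- The Schreier graph of the stabilizer of the germ at an infinite word. -/
noncomputable def germGraph (w : BinSeq) : GraphSpace (Fin 2) :=
  ⟦orbitalSchreierGraph ![x₀, x₁] ((1 : ThompsonF) : ThompsonF ⧸ germStabilizer w)⟧

theorem fixesBase_germGraph (w : BinSeq) (g : FreeGroup (Fin 2)) :
    (germGraph w).FixesBase g ↔ FreeGroup.lift ![x₀, x₁] g ∈ germStabilizer w := by
  rw [germGraph, GraphSpace.fixesBase_orbitalSchreierGraph, MulAction.Quotient.smul_coe,
    smul_eq_mul, mul_one, eq_comm, QuotientGroup.eq, inv_one, one_mul]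

/-- For each word separately, fixing `v` is eventually equivalent to being the identity near `w`.
The point `w` itself must be excluded, as an element may fix `w` without being the identity nearby.
-/
theorem tendsto_schreierGraph_binVal (w : BinSeq) :
    Filter.Tendsto (fun v => schreierGraph (binVal v)) (𝓝[≠] w) (𝓝 (germGraph w)) := by
  refine GraphSpace.tendsto_nhds_iff.mpr fun g => ?_
  simp only [fixesBase_schreierGraph_binVal, fixesBase_germGraph]
  rcases eventually_smul_eq_or_ne (FreeGroup.lift ![x₀, x₁] g) w with h | h
  · filter_upwards [nhdsWithin_le_nhds h] with v hv
    exact iff_of_true hv h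
  · by_cases hg : FreeGroup.lift ![x₀, x₁] g ∈ germStabilizer w
    · filter_upwards [nhdsWithin_le_nhds hg] with v hv
      exact iff_of_true hv hg
    · filter_upwards [h] with v hv
      exact iff_of_false hv hg

/-- Being the identity near `w` is an open condition on `w`; its failure is open too, by the same
dichotomy. -/
theorem continuous_germGraph : Continuous germGraph := by
  refine continuous_iff_continuousAt.mpr fun w => GraphSpace.tendsto_nhds_iff.mpr fun g => ?_
  simp only [fixesBase_germGraph]
  by_cases hg : FreeGroup.lift ![x₀, x₁] g ∈ germStabilizer w
  · filter_upwards [eventually_eventually_nhds.mpr hg] with v hv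
    exact iff_of_true hv hg
  · have h := (eventually_smul_eq_or_ne _ w).resolve_left hg
    rw [eventually_nhdsWithin_iff] at h
    filter_upwards [h] with v hv
    refine iff_of_false (fun hv' => ?_) hg
    rcases eq_or_ne v w with rfl | hne
    · exact hg hv'
    · exact hv hne (smul_eq_of_mem_germStabilizer hv')

theorem germGraph_injective : Function.Injective germGraph := by
  intro w v h
  refine germStabilizer_injective (Subgroup.ext fun f => ?_)
  obtain ⟨g, rfl⟩ := lift_x₀_x₁_surjective f
  rw [← fixesBase_germGraph, ← fixesBase_germGraph, h]

theorem isClosedEmbedding_germGraph : IsClosedEmbedding germGraph :=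
  continuous_germGraph.isClosedEmbedding germGraph_injective

theorem neBot_nhdsWithin_ne_word (w : BinSeq) : (𝓝[≠] w).NeBot := by
  have h := frequently_mem_orbitWords (x := ⟨1 / 2, by norm_num, by norm_num⟩)
    (by rw [← Subtype.coe_lt_coe]; norm_num) (by rw [← Subtype.coe_lt_coe]; norm_num) w
  exact Filter.neBot_iff.mpr fun hbot => by simp [hbot] at h

theorem perfect_range_germGraph : Perfect (range germGraph) := by
  refine ⟨isClosedEmbedding_germGraph.isClosed_range, ?_⟩
  rintro _ ⟨w, rfl⟩
  have := neBot_nhdsWithin_ne_word w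
  have h : Filter.Tendsto germGraph (𝓝[≠] w)
      (𝓝[≠] germGraph w ⊓ Filter.principal (range germGraph)) := by
    refine Filter.tendsto_inf.mpr ⟨?_, ?_⟩
    · exact continuous_germGraph.continuousAt.continuousWithinAt.tendsto_nhdsWithin
        fun v hv => germGraph_injective.ne hv
    · exact Filter.tendsto_principal.mpr (Filter.Eventually.of_forall mem_range_self)
  exact h.neBot

theorem schreierFamily_eq_image (x : I) :
    schreierFamily x = (fun w => schreierGraph (binVal w)) '' orbitWords x := by
  apply Subset.antisymm
  · rintro _ ⟨y, hy, rfl⟩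
    obtain ⟨w, rfl⟩ := exists_binVal_eq y
    exact ⟨w, hy, rfl⟩
  · rintro _ ⟨w, hw, rfl⟩
    exact ⟨_, hw, rfl⟩

theorem range_germGraph_subset_closure {x : I} (h0 : 0 < x) (h1 : x < 1) :
    range germGraph ⊆ closure (schreierFamily x) := by
  rintro _ ⟨w, rfl⟩
  exact mem_closure_of_frequently_of_tendsto
    ((frequently_mem_orbitWords h0 h1 w).mono fun v hv => mem_image_of_mem _ hv)
    (tendsto_schreierGraph_binVal w)

theorem derivedSet_schreierFamily_subset (x : I) :
    derivedSet (schreierFamily x) ⊆ range germGraph := by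
  intro Γ hΓ
  rw [schreierFamily_eq_image] at hΓ
  have hne : (Filter.comap (fun w => schreierGraph (binVal w)) (𝓝[≠] Γ)).NeBot := by
    rw [Filter.comap_neBot_iff_frequently]
    refine (accPt_iff_frequently_nhdsNE.mp hΓ).mono ?_
    rintro _ ⟨w, -, rfl⟩
    exact ⟨w, rfl⟩
  -- The cluster point `w` of words whose graphs tend to `Γ` is the candidate for the germ.
  obtain ⟨w, hw⟩ := exists_clusterPt_of_compactSpace
    (Filter.comap (fun w => schreierGraph (binVal w)) (𝓝[≠] Γ))
  refine ⟨w, ?_⟩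
  have hlim : Filter.Tendsto (fun w => schreierGraph (binVal w))
      (Filter.comap (fun w => schreierGraph (binVal w)) (𝓝[≠] Γ)) (𝓝[≠] Γ) :=
    Filter.tendsto_comap
  by_cases hbot : (𝓝[≠] w ⊓ Filter.comap (fun w => schreierGraph (binVal w)) (𝓝[≠] Γ)).NeBot
  · exact tendsto_nhds_unique ((tendsto_schreierGraph_binVal w).mono_left inf_le_left)
      ((hlim.mono_left inf_le_right).mono_right nhdsWithin_le_nhds)
  · exfalso
    rw [Filter.not_neBot] at hbot
    -- If the words cluster at `w` only through `w` itself, then `Γ` is the graph at `w`, while all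
    -- graphs along the filter differ from `Γ`.
    have hpure : 𝓝 w ⊓ Filter.comap (fun w => schreierGraph (binVal w)) (𝓝[≠] Γ) ≤ pure w := by
      rw [← nhdsNE_sup_pure, inf_sup_right, hbot, bot_sup_eq]
      exact inf_le_left
    have hcl : (𝓝 w ⊓ Filter.comap (fun w => schreierGraph (binVal w)) (𝓝[≠] Γ)).NeBot := hw
    have heq : schreierGraph (binVal w) = Γ :=
      tendsto_nhds_unique ((tendsto_pure_nhds (fun w => schreierGraph (binVal w)) w).mono_left hpure)
        ((hlim.mono_left inf_le_right).mono_right nhdsWithin_le_nhds)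
    have h1 : ∀ᶠ v in 𝓝 w ⊓ Filter.comap (fun w => schreierGraph (binVal w)) (𝓝[≠] Γ),
        schreierGraph (binVal v) ≠ Γ :=
      (hlim.mono_left inf_le_right).eventually self_mem_nhdsWithin
    have h2 : ∀ᶠ v in 𝓝 w ⊓ Filter.comap (fun w => schreierGraph (binVal w)) (𝓝[≠] Γ), v = w :=
      hpure (by simp)
    obtain ⟨v, hv1, rfl⟩ := (h1.and h2).exists
    exact hv1 heq

/-- Points of the kernel are accumulation points of the closure, hence of the family, hence germ
graphs. Conversely, the germ graphs form a perfect subset of the closure. -/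
theorem perfectKernel_closure_schreierFamily {x : I} (h0 : 0 < x) (h1 : x < 1) :
    CantorBendixson.perfectKernel (closure (schreierFamily x)) = range germGraph := by
  apply Subset.antisymm
  · intro Γ hΓ
    have h := (CantorBendixson.perfect_perfectKernel
      (isClosed_closure (s := schreierFamily x))).acc Γ hΓ
    apply derivedSet_schreierFamily_subset x
    rw [← derivedSet_closure]
    exact h.mono (Filter.principal_mono.mpr (CantorBendixson.perfectKernel_subset _))
  · exact perfect_range_germGraph.subset_perfectKernel (range_germGraph_subset_closure h0 h1)

theorem dyadicKernel_eq : dyadicKernel = range germGraph :=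
  perfectKernel_closure_schreierFamily (by rw [← Subtype.coe_lt_coe]; norm_num)
    (by rw [← Subtype.coe_lt_coe]; norm_num)

/-! ### The Schreier dynamical system -/

theorem smul_schreierGraph (g : FreeGroup (Fin 2)) (y : I) :
    g • schreierGraph y = schreierGraph (FreeGroup.lift ![x₀, x₁] g • y) := by
  ext h
  rw [GraphSpace.fixesBase_smul, schreierGraph, schreierGraph,
    GraphSpace.fixesBase_orbitalSchreierGraph, GraphSpace.fixesBase_orbitalSchreierGraph, map_mul,
    map_mul, map_inv, mul_smul, mul_smul, inv_smul_eq_iff]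

theorem smul_mem_schreierFamily_iff {x : I} (g : FreeGroup (Fin 2)) (Γ : GraphSpace (Fin 2)) :
    g • Γ ∈ schreierFamily x ↔ Γ ∈ schreierFamily x := by
  have key : ∀ (g : FreeGroup (Fin 2)) (Γ : GraphSpace (Fin 2)), Γ ∈ schreierFamily x →
      g • Γ ∈ schreierFamily x := by
    rintro g _ ⟨y, hy, rfl⟩
    rw [smul_schreierGraph]
    exact ⟨_, MulAction.mem_orbit_of_mem_orbit _ hy, rfl⟩
  exact ⟨fun h => by simpa using key g⁻¹ _ h, key g Γ⟩

theorem smul_mem_closure_schreierFamily_iff {x : I} (g : FreeGroup (Fin 2))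
    (Γ : GraphSpace (Fin 2)) :
    Γ ∈ closure (schreierFamily x) ↔
      (Homeomorph.smul g : GraphSpace (Fin 2) ≃ₜ _) Γ ∈ closure (schreierFamily x) := by
  have h : (Homeomorph.smul g : GraphSpace (Fin 2) ≃ₜ _) ⁻¹' schreierFamily x =
      schreierFamily x :=
    Set.ext fun Γ => smul_mem_schreierFamily_iff g Γ
  rw [← mem_preimage, Homeomorph.preimage_closure, h]

theorem closure_schreierFamily_hom_ext {x : I}
    {φ φ' : closure (schreierFamily x) ≃ₜ closure (schreierFamily x)}
    (h : ∀ y (hy : y ∈ MulAction.orbit ThompsonF x),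
      φ ⟨schreierGraph y, schreierGraph_mem_closure hy⟩ =
        φ' ⟨schreierGraph y, schreierGraph_mem_closure hy⟩) : φ = φ' := by
  have hdense : Dense {Γ : closure (schreierFamily x) | (Γ : GraphSpace (Fin 2)) ∈
      schreierFamily x} := by
    intro Γ
    rw [closure_subtype]
    refine closure_mono ?_ Γ.2
    exact fun Δ hΔ => ⟨⟨Δ, subset_closure hΔ⟩, hΔ, rfl⟩
  refine Homeomorph.ext fun Γ => ?_
  refine congrFun (Continuous.ext_on hdense φ.continuous φ'.continuous ?_) Γ
  rintro ⟨_, _⟩ ⟨y, hy, rfl⟩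
  exact h y hy

/-- The action of `F` on the closure of the family of Schreier graphs of the points of an orbit. -/
noncomputable def schreierSystem (x : I) :
    ThompsonF →* (closure (schreierFamily x) ≃ₜ closure (schreierFamily x)) :=
  -- An arbitrary word representing `f` is used. On the dense family the shift depends only on `f`,
  -- which makes the choice multiplicative.
  MonoidHom.mk' (fun f => (Homeomorph.smul (Function.surjInv lift_x₀_x₁_surjective f)).subtype
    (smul_mem_closure_schreierFamily_iff _)) fun f g => by
      refine closure_schreierFamily_hom_ext fun y hy => Subtype.ext ?_
      change (_ : FreeGroup (Fin 2)) • schreierGraph y =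
        (_ : FreeGroup (Fin 2)) • (_ : FreeGroup (Fin 2)) • schreierGraph y
      simp only [smul_schreierGraph, Function.surjInv_eq, mul_smul]

theorem isSchreierSystem_schreierSystem (x : I) : IsSchreierSystem x (schreierSystem x) := by
  intro f y hy
  change (_ : FreeGroup (Fin 2)) • schreierGraph y = _
  rw [smul_schreierGraph, Function.surjInv_eq lift_x₀_x₁_surjective]

theorem IsSchreierSystem.unique {x : I}
    {α β : ThompsonF →* (closure (schreierFamily x) ≃ₜ closure (schreierFamily x))}
    (hα : IsSchreierSystem x α) (hβ : IsSchreierSystem x β) : α = β :=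
  MonoidHom.ext fun f => closure_schreierFamily_hom_ext fun y hy =>
    Subtype.ext ((hα f y hy).trans (hβ f y hy).symm)

/-- Let `v` run through words of the orbit with `v → w`, `v ≠ w`. Then `Γ_v` tends to the germ graph
at `w`, its image `Γ_{f v}` tends to the one at `f • w`, and `α f` is continuous. -/
theorem IsSchreierSystem.apply_germGraph {x : I} (h0 : 0 < x) (h1 : x < 1)
    {α : ThompsonF →* (closure (schreierFamily x) ≃ₜ closure (schreierFamily x))}
    (hα : IsSchreierSystem x α) (f : ThompsonF) (w : BinSeq)
    (hw : germGraph w ∈ closure (schreierFamily x)) :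
    (α f ⟨germGraph w, hw⟩ : GraphSpace (Fin 2)) = germGraph (f • w) := by
  have hne : (Filter.comap ((↑) : orbitWords x → BinSeq) (𝓝[≠] w)).NeBot :=
    Filter.comap_neBot_iff_frequently.mpr
      ((frequently_mem_orbitWords h0 h1 w).mono fun v hv => ⟨⟨v, hv⟩, rfl⟩)
  have hval : Filter.Tendsto ((↑) : orbitWords x → BinSeq)
      (Filter.comap ((↑) : orbitWords x → BinSeq) (𝓝[≠] w)) (𝓝[≠] w) := Filter.tendsto_comap
  have hsmul : Filter.Tendsto (fun v => f • v) (𝓝[≠] w) (𝓝[≠] (f • w)) :=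
    (continuous_const_smul f).continuousAt.continuousWithinAt.tendsto_nhdsWithin
      fun v hv => (MulAction.injective f).ne hv
  have hlim : Filter.Tendsto (fun v : orbitWords x =>
      (⟨schreierGraph (binVal v), schreierGraph_mem_closure v.2⟩ : closure (schreierFamily x)))
      (Filter.comap ((↑) : orbitWords x → BinSeq) (𝓝[≠] w)) (𝓝 ⟨germGraph w, hw⟩) :=
    tendsto_subtype_rng.mpr ((tendsto_schreierGraph_binVal w).comp hval)
  have hα' := ((continuous_subtype_val.comp (α f).continuous).tendsto _).comp hlim
  refine tendsto_nhds_unique hα' ?_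
  refine ((tendsto_schreierGraph_binVal (f • w)).comp (hsmul.comp hval)).congr fun v => ?_
  simp only [Function.comp_apply]
  rw [(cantor_smul_spec f v).1, hα f (binVal v) v.2]

theorem mainTheorem11 :
    ∃ ψ : dyadicKernel ≃ₜ BinSeq, ∀ x : I, 0 < x → x < 1 →
      CantorBendixson.perfectKernel (closure (schreierFamily x)) = dyadicKernel ∧
      (∃! α, IsSchreierSystem x α) ∧
      ∀ α, IsSchreierSystem x α →
        ∀ (f : ThompsonF) (Γ : closure (schreierFamily x))
          (hΓ : (Γ : GraphSpace (Fin 2)) ∈ dyadicKernel),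
          ∃ hfΓ : (α f Γ : GraphSpace (Fin 2)) ∈ dyadicKernel,
            ψ ⟨α f Γ, hfΓ⟩ = f • ψ ⟨Γ, hΓ⟩ := by
  -- The germ graphs do not involve `x`, so one conjugacy serves all orbits.
  let φ : BinSeq ≃ₜ dyadicKernel :=
    isClosedEmbedding_germGraph.isEmbedding.toHomeomorph.trans
      (Homeomorph.setCongr dyadicKernel_eq.symm)
  have hφ : ∀ w h, φ.symm ⟨germGraph w, h⟩ = w := fun w h =>
    φ.symm_apply_eq.mpr (Subtype.ext rfl)
  refine ⟨φ.symm, fun x h0 h1 => ⟨?_, ?_, ?_⟩⟩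
  · rw [perfectKernel_closure_schreierFamily h0 h1, dyadicKernel_eq]
  · exact ⟨schreierSystem x, isSchreierSystem_schreierSystem x,
      fun α hα => hα.unique (isSchreierSystem_schreierSystem x)⟩
  · rintro α hα f ⟨Γ, hΓ'⟩ hΓ
    obtain ⟨w, rfl⟩ := dyadicKernel_eq ▸ hΓ
    have h := hα.apply_germGraph h0 h1 f w hΓ'
    refine ⟨by rw [h, dyadicKernel_eq]; exact ⟨_, rfl⟩, ?_⟩
    simp only [h, hφ]
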